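/- Let $n,m\ge 1$ be integers, let $\mathfrak{gl}_n$ be the Lie algebra of complex $n\times n$ matrices with matrix units $E_{ij}$, and let $S(\mathfrak{gl}_n^*)=\mathbb{C}[y_{ij}]_{1\le i,j\le n}$ be the ring of polynomial functions on $\mathfrak{gl}_n$, where $y_{ij}$ are the matrix entries. Let $R=S(\mathfrak{gl}_n^*)^{\mathfrak{gl}_n}$ be the subring of functions invariant under conjugation by $\mathrm{GL}_n(\mathbb{C})$, and for $0\le k\le n$ let $c_k(Y)=\operatorname{tr}(\Lambda^k Y)\in R$, the sum of the principal $k\times k$ minors of $Y$. For a finite-dimensional representation $\pi\colon\mathfrak{gl}_n\to\operatorname{End}V$ let $\mathbf{D}$ be the Kirillov--Wei operator on $S(\mathfrak{gl}_n^*)\otimes\operatorname{End}V$ (polynomial maps $F\colon\mathfrak{gl}_n\to\operatorname{End}V$), $$(\mathbf{D}F)(Y)=\sum_{i,j=1}^n\frac{\partial F}{\partial y_{ji}}(Y)\cdot\pi(E_{ij}),$$ and let the big algebra $\mathscr{B}(V)$ be the subalgebra of $S(\mathfrak{gl}_n^*)\otimes\operatorname{End}V$ generated by the elements $M_{p,q}=\mathbf{D}^q(c_{p+q}\cdot\operatorname{Id}_V)$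 with $p,q\ge 0$ and $p+q\le n$. It contains $R$ (acting by scalar operators) and is thus an $R$-algebra. Write $\mathscr{B}(m\varpi_1)=\mathscr{B}(S^m(\mathbb{C}^n))$ for the big algebra of the $m$-th symmetric power of the vector representation, and in particular $\mathscr{B}(\varpi_1)=\mathscr{B}(\mathbb{C}^n)$. Let $S^m(\mathscr{B}(\varpi_1))$ be the $R$-subalgebra of $\mathfrak{S}_m$-invariant elements of the $m$-fold tensor power $\mathscr{B}(\varpi_1)^{\otimes m}$ over $R$, where $\mathfrak{S}_m$ permutes the tensor factors. Then there is an isomorphism of $R$-algebras $$\mathscr{B}(m\varpi_1)\simeq S^m(\mathscr{B}(\varpi_1)).$$ -/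

import Mathlib

open scoped TensorProduct

attribute [local instance 100] LieRing.ofAssociativeRing

noncomputable section

namespace BigAlg

/-- `S(gl_n^*) = ℂ[y_ij]`, the ring of polynomial functions on `gl_n`. -/
abbrev PolyGl (n : ℕ) : Type := MvPolynomial (Fin n × Fin n) ℂ

/-- The generic matrix `Y = [y_ij]`. -/
abbrev genericMatrix (n : ℕ) : Matrix (Fin n) (Fin n) (PolyGl n) :=
  Matrix.mvPolynomialX (Fin n) (Fin n) ℂ

/-- The substitution `f(Y) ↦ f(g Y g⁻¹)` on polynomial functions on `gl_n`. -/
def adSubst {n : ℕ} (g : GL (Fin n) ℂ) : PolyGl n →ₐ[ℂ] PolyGl n :=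
  MvPolynomial.aeval fun ij =>
    ((g : Matrix (Fin n) (Fin n) ℂ).map MvPolynomial.C * genericMatrix n *
      ((g⁻¹ : GL (Fin n) ℂ) : Matrix (Fin n) (Fin n) ℂ).map MvPolynomial.C :
        Matrix (Fin n) (Fin n) (PolyGl n)) ij.1 ij.2

/-- The ring of polynomial functions on `gl_n` that are invariant under the adjoint action
of `GL_n`. -/
def invariantRing (n : ℕ) : Subalgebra ℂ (PolyGl n) where
  carrier := {f | ∀ g : GL (Fin n) ℂ, adSubst g f = f}
  mul_mem' ha hb g := by rw [map_mul, ha g, hb g]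
  add_mem' ha hb g := by rw [map_add, ha g, hb g]
  algebraMap_mem' r g := by simp

/-- `S(gl_n^*)^{gl_n}`, as a ring in its own right. -/
def InvRing (n : ℕ) : Type := invariantRing n

instance (n : ℕ) : CommRing (InvRing n) := inferInstanceAs (CommRing (invariantRing n))

instance (n : ℕ) : Algebra ℂ (InvRing n) := inferInstanceAs (Algebra ℂ (invariantRing n))

/-- `c_k(Y) = tr Λ^k Y`, the sum of the principal `k × k` minors of `Y`. -/
def minorSum (n k : ℕ) : PolyGl n :=
  ∑ s ∈ (Finset.univ : Finset (Fin n)).powersetCard k,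
    ((genericMatrix n).submatrix (Subtype.val : s → Fin n) (Subtype.val : s → Fin n)).det

/-- `S(gl_n^*) ⊗ End V`, the algebra of polynomial maps `gl_n → End V`. -/
def PolyEnd (n : ℕ) (V : Type*) [AddCommGroup V] [Module ℂ V] : Type _ :=
  PolyGl n ⊗[ℂ] Module.End ℂ V

section Representation

variable {n : ℕ} {V : Type*} [AddCommGroup V] [Module ℂ V]

instance : Ring (PolyEnd n V) :=
  inferInstanceAs (Ring (PolyGl n ⊗[ℂ] Module.End ℂ V))

instance : Algebra ℂ (PolyEnd n V) :=
  inferInstanceAs (Algebra ℂ (PolyGl n ⊗[ℂ] Module.End ℂ V))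

/-- Invariant polynomials act as scalar operators: `r ↦ r ⊗ 1`. -/
instance : Algebra (InvRing n) (PolyEnd n V) :=
  inferInstanceAs (Algebra (invariantRing n) (PolyGl n ⊗[ℂ] Module.End ℂ V))

/-- The Kirillov--Wei operator `(D F)(Y) = ∑ i j, (∂F/∂y_ji)(Y) · π(E_ij)` of a
representation `π` of `gl_n`. -/
def kirillovWei (π : Matrix (Fin n) (Fin n) ℂ →ₗ⁅ℂ⁆ Module.End ℂ V) :
    PolyEnd n V →ₗ[ℂ] PolyEnd n V :=
  (∑ i : Fin n, ∑ j : Fin n,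
    TensorProduct.map (MvPolynomial.pderiv (j, i)).toLinearMap
      (LinearMap.mulRight ℂ (π (Matrix.single i j 1))) :
    PolyGl n ⊗[ℂ] Module.End ℂ V →ₗ[ℂ] PolyGl n ⊗[ℂ] Module.End ℂ V)

/-- `M_{p,q} = D^q (c_{p+q})`, where `c_{p+q}` is viewed as a scalar operator. -/
def bigGen (π : Matrix (Fin n) (Fin n) ℂ →ₗ⁅ℂ⁆ Module.End ℂ V) (p q : ℕ) :
    PolyEnd n V :=
  (kirillovWei π ^ q) (minorSum n (p + q) ⊗ₜ[ℂ] (1 : Module.End ℂ V) : PolyGl n ⊗[ℂ] Module.End ℂ V)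

/-- The complex subalgebra generated by the `M_{p,q}`, `p + q ≤ n`. -/
def bigAlgebraComplex (π : Matrix (Fin n) (Fin n) ℂ →ₗ⁅ℂ⁆ Module.End ℂ V) :
    Subalgebra ℂ (PolyEnd n V) :=
  Algebra.adjoin ℂ {F | ∃ p q : ℕ, p + q ≤ n ∧ F = bigGen π p q}

end Representation

/-! Invariant polynomials are polynomials in the `c_k`; hence the complex algebra generated by
the `M_{p,q}` contains all invariant polynomials (as scalar operators). -/

section Invariants

open MvPolynomial

theorem mem_invariantRing {n : ℕ} {f : PolyGl n} :
    f ∈ invariantRing n ↔ ∀ g : GL (Fin n) ℂ, adSubst g f = f := Iff.rfl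

/-- Evaluation of a polynomial function at a matrix. -/
def evalAt {n : ℕ} (A : Matrix (Fin n) (Fin n) ℂ) : PolyGl n →ₐ[ℂ] ℂ :=
  aeval fun ij => A ij.1 ij.2

theorem evalAt_generic {n : ℕ} (A : Matrix (Fin n) (Fin n) ℂ) :
    (genericMatrix n).map (evalAt A) = A := by
  ext i j; simp [evalAt, genericMatrix]

theorem eval_eq_evalAt {n : ℕ} (a : Fin n × Fin n → ℂ) (f : PolyGl n) :
    eval a f = evalAt (Matrix.of fun i j => a (i, j)) f := by
  rw [evalAt, ← MvPolynomial.coe_aeval_eq_eval]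
  rfl

theorem evalAt_adSubst {n : ℕ} (A : Matrix (Fin n) (Fin n) ℂ) (g : GL (Fin n) ℂ) (f : PolyGl n) :
    evalAt A (adSubst g f) =
      evalAt ((g : Matrix (Fin n) (Fin n) ℂ) * A * ((g⁻¹ : GL (Fin n) ℂ) : Matrix (Fin n) (Fin n) ℂ)) f := by
  have : (evalAt A).comp (adSubst g) = evalAt ((g : Matrix (Fin n) (Fin n) ℂ) * A * ((g⁻¹ : GL (Fin n) ℂ) : Matrix (Fin n) (Fin n) ℂ)) := by
    apply MvPolynomial.algHom_ext
    intro ij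
    simp [adSubst, evalAt, Matrix.mul_apply, Matrix.mvPolynomialX]
  exact DFunLike.congr_fun this f

theorem minorSum_eq (n k : ℕ) (hk : k ≤ n) :
    minorSum n k = (-1) ^ k * (genericMatrix n).charpoly.coeff (n - k) := by
  have := Matrix.charpoly_coeff_eq_sum_minors (genericMatrix n) k (by simpa using hk)
  rw [Fintype.card_fin] at this
  rw [this, ← mul_assoc, ← mul_pow]
  simp [minorSum]

theorem evalAt_minorSum {n : ℕ} (k : ℕ) (hk : k ≤ n) (A : Matrix (Fin n) (Fin n) ℂ) :
    evalAt A (minorSum n k) = (-1) ^ k * A.charpoly.coeff (n - k) := by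
  rw [minorSum_eq n k hk, map_mul, map_pow, map_neg, map_one]
  congr 1
  conv_rhs => rw [← evalAt_generic A]
  have := Matrix.charpoly_map (genericMatrix n) (evalAt A).toRingHom
  have h2 := congrArg (fun p => p.coeff (n - k)) this
  simp only [Polynomial.coeff_map] at h2
  exact h2.symm

theorem minorSum_mem {n : ℕ} (k : ℕ) (hk : k ≤ n) : minorSum n k ∈ invariantRing n := by
  rw [mem_invariantRing]
  intro g
  apply MvPolynomial.funext
  intro a
  rw [eval_eq_evalAt, eval_eq_evalAt]
  generalize (Matrix.of fun i j => a (i, j) : Matrix (Fin n) (Fin n) ℂ) = A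
  rw [evalAt_adSubst, evalAt_minorSum k hk, evalAt_minorSum k hk]
  rw [Matrix.coe_units_inv, Matrix.charpoly_units_conj g A]

/-- Restriction of a polynomial function to diagonal matrices. -/
def diagRestr (n : ℕ) : PolyGl n →ₐ[ℂ] MvPolynomial (Fin n) ℂ :=
  aeval fun ij => if ij.1 = ij.2 then X ij.1 else 0

theorem diagRestr_minorSum (n k : ℕ) : diagRestr n (minorSum n k) = esymm (Fin n) ℂ k := by
  rw [minorSum, map_sum, esymm]
  refine Finset.sum_congr rfl fun s _ => ?_
  rw [AlgHom.map_det]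
  have : (diagRestr n).mapMatrix ((genericMatrix n).submatrix (Subtype.val : s → Fin n) (Subtype.val : s → Fin n))
      = Matrix.diagonal fun i : s => X i.1 := by
    ext1 i j
    simp only [diagRestr, AlgHom.mapMatrix_apply, Matrix.map_apply, Matrix.submatrix_apply, Matrix.mvPolynomialX_apply, aeval_X, Matrix.diagonal_apply, Subtype.ext_iff]
  rw [this, Matrix.det_diagonal]
  exact Finset.prod_coe_sort s (fun i => X i)

theorem eval_diagRestr {n : ℕ} (d : Fin n → ℂ) (f : PolyGl n) :
    eval d (diagRestr n f) = evalAt (Matrix.diagonal d) f := by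
  have : (aeval d : MvPolynomial (Fin n) ℂ →ₐ[ℂ] ℂ).comp (diagRestr n) = evalAt (Matrix.diagonal d) := by
    apply MvPolynomial.algHom_ext
    intro ij
    simp only [AlgHom.comp_apply, diagRestr, evalAt, aeval_X, Matrix.diagonal_apply]
    split_ifs <;> simp
  have h := DFunLike.congr_fun this f
  simpa [MvPolynomial.aeval_eq_eval] using h

theorem diagRestr_symm {n : ℕ} {f : PolyGl n} (hf : f ∈ invariantRing n) :
    (diagRestr n f).IsSymmetric := by
  intro e
  apply MvPolynomial.funext
  intro d
  rw [eval_rename, eval_diagRestr, eval_diagRestr]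
  let g : GL (Fin n) ℂ := ⟨e.permMatrix ℂ, e⁻¹.permMatrix ℂ, by
    rw [← Matrix.permMatrix_mul]; simp, by rw [← Matrix.permMatrix_mul]; simp⟩
  conv_rhs => rw [← hf g]
  rw [evalAt_adSubst]
  have : (g : Matrix (Fin n) (Fin n) ℂ) * Matrix.diagonal d * ((g⁻¹ : GL (Fin n) ℂ) : Matrix (Fin n) (Fin n) ℂ)
      = Matrix.diagonal (d ∘ e) := by
    ext1 i j
    simp [g, Equiv.Perm.permMatrix, Matrix.diagonal_apply, PEquiv.toMatrix_toPEquiv_mul, PEquiv.mul_toMatrix_toPEquiv]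
    congr 1
    exact propext e.injective.eq_iff
  rw [this]

theorem exists_diag {n : ℕ} (A : Matrix (Fin n) (Fin n) ℂ) (hA : A.charpoly.Separable) :
    ∃ (g : GL (Fin n) ℂ) (d : Fin n → ℂ),
      (g : Matrix (Fin n) (Fin n) ℂ) * A * ((g⁻¹ : GL (Fin n) ℂ) : Matrix (Fin n) (Fin n) ℂ) =
        Matrix.diagonal d := by
  have hcard : Fintype.card (A.charpoly.roots.toFinset) = n := by
    rw [Fintype.card_coe, Multiset.toFinset_card_of_nodup (Polynomial.nodup_roots hA),
      Polynomial.splits_iff_card_roots.mp (IsAlgClosed.splits _), Matrix.charpoly_natDegree_eq_dim,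
      Fintype.card_fin]
  let e := (Fintype.equivFinOfCardEq hcard).symm
  let d : Fin n → ℂ := fun i => (e i).1
  have hd : Function.Injective d := Subtype.val_injective.comp e.injective
  have hev : ∀ i, ∃ v, Module.End.HasEigenvector (Matrix.toLin' A) (d i) v := fun i => by
    apply Module.End.HasEigenvalue.exists_hasEigenvector
    rw [Module.End.hasEigenvalue_iff_isRoot_charpoly, Matrix.charpoly_toLin']
    exact Polynomial.isRoot_of_mem_roots (Multiset.mem_toFinset.mp (e i).2)
  choose v hv using hev
  have hli := Module.End.eigenvectors_linearIndependent' (Matrix.toLin' A) d hd v hv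
  let P : Matrix (Fin n) (Fin n) ℂ := Matrix.of fun i j => v j i
  have hP : IsUnit P := by
    rw [← Matrix.linearIndependent_cols_iff_isUnit]
    exact hli
  obtain ⟨u, hu⟩ := hP
  refine ⟨u⁻¹, d, ?_⟩
  have hAP : A * P = P * Matrix.diagonal d := by
    ext1 i j
    have h1 := congrFun (hv j).apply_eq_smul i
    rw [Matrix.toLin'_apply] at h1
    rw [Matrix.mul_diagonal, Matrix.mul_apply]
    simpa [P, Matrix.mulVec, dotProduct, mul_comm] using h1
  rw [inv_inv, mul_assoc, hu, hAP, ← hu, ← mul_assoc, Units.inv_mul, one_mul]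

theorem eq_zero_of_diagRestr {n : ℕ} {f : PolyGl n} (hf : f ∈ invariantRing n)
    (h0 : diagRestr n f = 0) : f = 0 := by
  let p := (genericMatrix n).charpoly
  let r : PolyGl n := Polynomial.resultant p p.derivative n (n - 1)
  have hr : ∀ A : Matrix (Fin n) (Fin n) ℂ,
      evalAt A r = Polynomial.resultant A.charpoly A.charpoly.derivative := fun A => by
    have h1 : p.map (evalAt A).toRingHom = A.charpoly := by
      have := Matrix.charpoly_map (genericMatrix n) (evalAt A).toRingHom
      rw [← this]
      congr 1
      exact evalAt_generic A
    have h2 : A.charpoly.natDegree = n := by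
      rw [Matrix.charpoly_natDegree_eq_dim, Fintype.card_fin]
    rw [Polynomial.natDegree_derivative, h2, ← h1, Polynomial.derivative_map,
      Polynomial.resultant_map_map]
    rfl
  have hr0 : r ≠ 0 := by
    intro h
    have h1 := hr (Matrix.diagonal fun i : Fin n => ((i : ℕ) : ℂ))
    rw [h, map_zero, eq_comm, Polynomial.resultant_eq_zero_iff] at h1
    refine h1.2 ?_
    rw [← Polynomial.separable_def, Matrix.charpoly_diagonal]
    refine Polynomial.separable_prod_X_sub_C_iff.mpr ?_
    intro i j hij
    exact Fin.ext (Nat.cast_injective hij)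
  have hfr : f * r = 0 := by
    apply MvPolynomial.funext
    intro a
    rw [map_mul, eval_eq_evalAt, eval_eq_evalAt, map_zero]
    generalize (Matrix.of fun i j => a (i, j) : Matrix (Fin n) (Fin n) ℂ) = A
    by_cases hA : A.charpoly.Separable
    · obtain ⟨g, d, hg⟩ := exists_diag A hA
      rw [← hf g, evalAt_adSubst, hg, ← eval_diagRestr, h0, map_zero, zero_mul]
    · rw [hr A, Polynomial.resultant_eq_zero_iff.mpr, mul_zero]
      exact ⟨Or.inl (Matrix.charpoly_monic A).ne_zero, hA⟩
  exact (mul_eq_zero.mp hfr).resolve_right hr0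

theorem invariant_mem_adjoin {n : ℕ} {f : PolyGl n} (hf : f ∈ invariantRing n) :
    f ∈ Algebra.adjoin ℂ {c | ∃ k ≤ n, c = minorSum n k} := by
  obtain ⟨P, hP⟩ := esymmAlgHom_surjective (σ := Fin n) (R := ℂ) (n := n) (by simp) ⟨_, diagRestr_symm hf⟩
  set f' : PolyGl n := aeval (fun i : Fin n => minorSum n (i + 1)) P with hf'
  have hP' : aeval (fun i : Fin n => esymm (Fin n) ℂ (i + 1)) P = diagRestr n f := by
    rw [← esymmAlgHom_apply, hP]
  have hmem : f' ∈ Algebra.adjoin ℂ {c | ∃ k ≤ n, c = minorSum n k} := by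
    have := (aeval (R := ℂ) (fun i : Fin n => minorSum n (i + 1))).mem_range_self P
    rw [← Algebra.adjoin_range_eq_range_aeval] at this
    refine Algebra.adjoin_mono ?_ this
    rintro _ ⟨i, rfl⟩
    exact ⟨i + 1, i.2, rfl⟩
  have hle : Algebra.adjoin ℂ {c | ∃ k ≤ n, c = minorSum n k} ≤ invariantRing n := by
    refine Algebra.adjoin_le ?_
    rintro _ ⟨k, hk, rfl⟩
    exact minorSum_mem k hk
  have hz : f - f' = 0 := by
    apply eq_zero_of_diagRestr (sub_mem hf (hle hmem))
    rw [map_sub, ← hP', hf', sub_eq_zero]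
    have : (diagRestr n).comp (aeval fun i : Fin n => minorSum n (i + 1)) =
        aeval (fun i : Fin n => esymm (Fin n) ℂ (i + 1)) := by
      apply MvPolynomial.algHom_ext
      intro i
      simp [diagRestr_minorSum]
    exact (DFunLike.congr_fun this P).symm
  rw [sub_eq_zero.mp hz]
  exact hmem

end Invariants

section Representation

variable {n : ℕ} {V : Type*} [AddCommGroup V] [Module ℂ V]

theorem algebraMap_mem_bigAlgebraComplex
    (π : Matrix (Fin n) (Fin n) ℂ →ₗ⁅ℂ⁆ Module.End ℂ V) (f : InvRing n) :
    algebraMap (InvRing n) (PolyEnd n V) f ∈ bigAlgebraComplex π := by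
  let ι : PolyGl n →ₐ[ℂ] PolyEnd n V :=
    (Algebra.TensorProduct.includeLeft : PolyGl n →ₐ[ℂ] PolyGl n ⊗[ℂ] Module.End ℂ V)
  have h1 : ι (f : invariantRing n).1 ∈ (Algebra.adjoin ℂ {c | ∃ k ≤ n, c = minorSum n k}).map ι :=
    ⟨_, invariant_mem_adjoin (f : invariantRing n).2, rfl⟩
  rw [AlgHom.map_adjoin] at h1
  refine Algebra.adjoin_mono ?_ h1
  rintro _ ⟨_, ⟨k, hk, rfl⟩, rfl⟩
  refine ⟨k, 0, by omega, ?_⟩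
  simp only [bigGen, add_zero, pow_zero]
  rfl

/-- The big algebra of `π`: the subalgebra generated by the `M_{p,q}`, `p + q ≤ n`, regarded
as an algebra over the ring of invariant polynomials, which it contains. -/
def bigAlgebra (π : Matrix (Fin n) (Fin n) ℂ →ₗ⁅ℂ⁆ Module.End ℂ V) :
    Subalgebra (InvRing n) (PolyEnd n V) :=
  { (bigAlgebraComplex π).toSubsemiring with
    algebraMap_mem' := algebraMap_mem_bigAlgebraComplex π }

end Representation

/-- The action `L(A) = ∑ i j, A_ij x_i ∂_j` of `A ∈ gl_n` on `S(ℂ^n) = ℂ[x_1, …, x_n]`. -/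
def polyAct {n : ℕ} (A : Matrix (Fin n) (Fin n) ℂ) :
    Module.End ℂ (MvPolynomial (Fin n) ℂ) :=
  ∑ i : Fin n, ∑ j : Fin n, A i j •
    (LinearMap.mulLeft ℂ (MvPolynomial.X i) ∘ₗ (MvPolynomial.pderiv j).toLinearMap)

theorem polyAct_apply {n : ℕ} (A : Matrix (Fin n) (Fin n) ℂ) (f : MvPolynomial (Fin n) ℂ) :
    polyAct A f = ∑ i : Fin n, ∑ j : Fin n, A i j • (MvPolynomial.X i * MvPolynomial.pderiv j f) := by
  simp [polyAct]

theorem polyAct_mem {n m : ℕ} (A : Matrix (Fin n) (Fin n) ℂ) (f : MvPolynomial (Fin n) ℂ)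
    (hf : f ∈ MvPolynomial.homogeneousSubmodule (Fin n) ℂ m) :
    polyAct A f ∈ MvPolynomial.homogeneousSubmodule (Fin n) ℂ m := by
  rw [polyAct_apply]
  refine Submodule.sum_mem _ fun i _ => Submodule.sum_mem _ fun j _ => Submodule.smul_mem _ _ ?_
  rw [MvPolynomial.mem_homogeneousSubmodule] at hf ⊢
  obtain _ | m := m
  · obtain ⟨c, rfl⟩ : ∃ c, f = MvPolynomial.C c :=
      ⟨_, MvPolynomial.totalDegree_eq_zero_iff_eq_C.mp (Nat.le_zero.mp hf.totalDegree_le)⟩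
    simpa using MvPolynomial.isHomogeneous_zero _ _ _
  · simpa [add_comm] using (MvPolynomial.isHomogeneous_X ℂ i).mul (hf.pderiv (i := j))

theorem polyAct_lie {n : ℕ} (A B : Matrix (Fin n) (Fin n) ℂ) :
    polyAct ⁅A, B⁆ = ⁅polyAct A, polyAct B⁆ := by
  have hder : ∀ A : Matrix (Fin n) (Fin n) ℂ, polyAct A =
      (∑ i : Fin n, ∑ j : Fin n, A i j •
        ((MvPolynomial.X i : MvPolynomial (Fin n) ℂ) • MvPolynomial.pderiv j) :
        Derivation ℂ (MvPolynomial (Fin n) ℂ) (MvPolynomial (Fin n) ℂ)).toLinearMap := by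
    intro A
    apply LinearMap.ext
    intro f
    have hs : ∀ {ι : Type} (s : Finset ι)
        (D : ι → Derivation ℂ (MvPolynomial (Fin n) ℂ) (MvPolynomial (Fin n) ℂ)),
        (∑ i ∈ s, D i) f = ∑ i ∈ s, D i f := fun s D => by
      have := congrFun (map_sum (Derivation.coeFnAddMonoidHom (R := ℂ)
        (A := MvPolynomial (Fin n) ℂ) (M := MvPolynomial (Fin n) ℂ)) D s) f
      rw [Finset.sum_apply] at this
      exact this
    rw [polyAct_apply, Derivation.coeFn_coe]
    simp only [hs, Derivation.smul_apply, smul_eq_mul]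
  have hX : ∀ (A : Matrix (Fin n) (Fin n) ℂ) (k : Fin n),
      polyAct A (MvPolynomial.X k) = ∑ i : Fin n, A i k • MvPolynomial.X i := by
    intro A k
    rw [polyAct_apply]
    refine Finset.sum_congr rfl fun i _ => ?_
    rw [Finset.sum_eq_single k]
    · simp
    · intro j _ hj
      simp [MvPolynomial.pderiv_X_of_ne hj.symm]
    · simp
  rw [hder, hder, hder, ← Derivation.commutator_coe_linear_map]
  congr 1
  apply MvPolynomial.derivation_ext
  intro k
  rw [Derivation.commutator_apply]
  have hc : ∀ (A : Matrix (Fin n) (Fin n) ℂ) f, (∑ i : Fin n, ∑ j : Fin n, A i j •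
        ((MvPolynomial.X i : MvPolynomial (Fin n) ℂ) • MvPolynomial.pderiv j) :
        Derivation ℂ (MvPolynomial (Fin n) ℂ) (MvPolynomial (Fin n) ℂ)) f = polyAct A f :=
    fun A f => (LinearMap.congr_fun (hder A) f).symm
  rw [hc, hc, hc, hc, hc, hX, hX, hX, map_sum, map_sum]
  simp only [map_smul, hX, LieRing.of_associative_ring_bracket, Matrix.sub_apply, sub_smul,
    Finset.sum_sub_distrib, Matrix.mul_apply, Finset.sum_smul, Finset.smul_sum, smul_smul]
  congr 1
  · rw [Finset.sum_comm]
    simp only [mul_comm]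
  · rw [Finset.sum_comm]
    simp only [mul_comm]

/-- The representation of `gl_n` on `S^m(ℂ^n) = ℂ[x_1, …, x_n]_m`, the irreducible
representation of highest weight `m ϖ_1`. For `m = 1` this is the vector representation `ℂ^n`,
with basis `x_1, …, x_n` and `E_ij x_k = δ_jk x_i`. -/
def symPowRep (n m : ℕ) :
    Matrix (Fin n) (Fin n) ℂ →ₗ⁅ℂ⁆
      Module.End ℂ (MvPolynomial.homogeneousSubmodule (Fin n) ℂ m) where
  toFun A := (polyAct A).restrict (polyAct_mem A)
  map_add' A B := by
    ext1 f; apply Subtype.ext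
    simp [polyAct_apply, add_smul, Finset.sum_add_distrib]
  map_smul' c A := by
    ext1 f; apply Subtype.ext
    simp [polyAct_apply, mul_smul, Finset.smul_sum]
  map_lie' {A B} := by
    ext1 f; apply Subtype.ext
    have h := LinearMap.congr_fun (polyAct_lie A B) f
    simpa [LieRing.of_associative_ring_bracket] using h

section SymmetricPower

variable (R : Type*) [CommRing R] (A : Type*) [Ring A] [Algebra R A] (m : ℕ)

theorem reindex_mul (σ : Equiv.Perm (Fin m)) (x y : ⨂[R] _ : Fin m, A) :
    PiTensorProduct.reindex R (fun _ => A) σ (x * y) =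
      PiTensorProduct.reindex R (fun _ => A) σ x * PiTensorProduct.reindex R (fun _ => A) σ y := by
  induction x using PiTensorProduct.induction_on with
  | add x x' hx hx' => rw [add_mul, map_add, hx, hx', map_add, add_mul]
  | smul_tprod r f =>
    induction y using PiTensorProduct.induction_on with
    | add y y' hy hy' => rw [mul_add, map_add, hy, hy', map_add, mul_add]
    | smul_tprod s g =>
      simp only [map_smul, smul_mul_assoc, mul_smul_comm, PiTensorProduct.tprod_mul_tprod,
        PiTensorProduct.reindex_tprod]
      rfl

/-- The subalgebra of `S_m`-invariants in the `m`-fold tensor power of `A` over `R`. -/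
def symPower : Subalgebra R (⨂[R] _ : Fin m, A) where
  carrier := {x | ∀ σ : Equiv.Perm (Fin m), PiTensorProduct.reindex R (fun _ => A) σ x = x}
  mul_mem' ha hb σ := by rw [reindex_mul, ha σ, hb σ]
  add_mem' ha hb σ := by rw [map_add, ha σ, hb σ]
  algebraMap_mem' r σ := by
    rw [Algebra.algebraMap_eq_smul_one, map_smul, PiTensorProduct.one_def, PiTensorProduct.reindex_tprod]
    rfl

end SymmetricPower

end BigAlg

end

/-! Write `Y` for the generic matrix, `R` for the invariant ring and `π` for the action on
`S^m(ℂ^n)`. Both algebras are generated over `R` by elements indexed by the powers `Y^k`, and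
matching these generators gives the isomorphism.

On the operator side the generators are the `π(Y^k)`. Applying `D` to `c_k` gives `π(grad c_k)`.
Applying `D` to `π(Z)` produces products `π(E_ij)π(E_ab)`. On a symmetric power their normally
ordered part `x_i x_a ∂_j ∂_b` is symmetric in `i`, `a`, while the second derivatives of a
determinant are antisymmetric there. Only the contraction survives, so `D` again gives some `π(Z')`
(`kirillovWei_matOp`). All matrices so obtained lie in the `R`-span of the powers of `Y`, and
Newton's identities recover the powers from the gradients of the `c_k`
(`bigAlgebra_symPowRep_eq_adjoin`).

On the tensor side, for `m = 1` the map `π` is multiplicative, so `B(ϖ_1)` is generated by the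
single element `y = π(Y)`. Symmetric polynomials in characteristic zero are generated by power sums,
hence the symmetric tensors are generated by the sums of `y^k` over the `m` places
(`symPower_eq_adjoin`).

The isomorphism is given by its graph, the subalgebra of the product generated by the pairs of
corresponding generators. Its projections have the right images, and injectivity is a comparison of
eigenvalues: at `diag(d)` the operator component multiplies `∏ x_{i l}` by the value at the tensor
component of the character sending `y` in place `l` to `d_{i l}`. These characters detect zero among
tensors (`eq_zero_of_diagChar`). An operator in the graph algebra that vanishes at diagonal matrices
vanishes by equivariance at all matrices with separable characteristic polynomial, hence
identically. -/

noncomputable section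

namespace BigAlg

open MvPolynomial

/-! ### Symmetric tensors over a monogenic commutative algebra. -/

section SymmetricTensors

/-- Newton's identities express `k e_k` through power sums and lower `e_j`; dividing by `k` is what
needs `ℚ`. -/
theorem esymm_mem_adjoin_psum {σ R : Type*} [Fintype σ] [CommRing R] [Algebra ℚ R] (k : ℕ) :
    esymm σ R k ∈ Algebra.adjoin R (Set.range (psum σ R)) := by
  classical
  induction k using Nat.strong_induction_on with
  | _ k ih =>
    rcases Nat.eq_zero_or_pos k with rfl | hk
    · simp [one_mem]
    · have h := mul_esymm_eq_sum σ R k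
      have hmem : (k : MvPolynomial σ R) * esymm σ R k ∈
          Algebra.adjoin R (Set.range (psum σ R)) := by
        rw [h]
        refine mul_mem (pow_mem (neg_mem (one_mem _)) _) (sum_mem fun a ha => ?_)
        exact mul_mem (mul_mem (pow_mem (neg_mem (one_mem _)) _)
          (ih _ (Finset.mem_filter.mp ha).2)) (Algebra.subset_adjoin ⟨_, rfl⟩)
      have h2 : esymm σ R k =
          algebraMap ℚ R (k : ℚ)⁻¹ • ((k : MvPolynomial σ R) * esymm σ R k) := by
        rw [smul_eq_C_mul, ← mul_assoc, ← map_natCast (C : R →+* MvPolynomial σ R) k, ← C_mul,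
          ← map_natCast (algebraMap ℚ R) k, ← map_mul, inv_mul_cancel₀ (by positivity)]
        simp
      rw [h2]
      exact Subalgebra.smul_mem _ hmem _

theorem isSymmetric_mem_adjoin_psum {σ R : Type*} [Fintype σ] [CommRing R] [Algebra ℚ R]
    {Q : MvPolynomial σ R} (hQ : Q.IsSymmetric) :
    Q ∈ Algebra.adjoin R (Set.range (psum σ R)) := by
  obtain ⟨P, hP⟩ := esymmAlgHom_surjective (σ := σ) (R := R) (n := Fintype.card σ) le_rfl ⟨Q, hQ⟩
  have h : aeval (fun i : Fin (Fintype.card σ) => esymm σ R (i + 1)) P = Q := by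
    rw [← esymmAlgHom_apply, hP]
  rw [← h]
  have h1 := (aeval (R := R) (fun i : Fin (Fintype.card σ) => esymm σ R (i + 1))).mem_range_self P
  rw [← Algebra.adjoin_range_eq_range_aeval] at h1
  refine Algebra.adjoin_le ?_ h1
  rintro _ ⟨i, rfl⟩
  exact esymm_mem_adjoin_psum _

variable {R : Type*} [CommRing R] (m : ℕ)

/-- `∑ l, 1 ⊗ ⋯ ⊗ a ⊗ ⋯ ⊗ 1`, with `a` in the `l`-th place. -/
def tensorTrace {A : Type*} [Ring A] [Algebra R A] (a : A) : ⨂[R] _ : Fin m, A :=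
  ∑ l : Fin m, PiTensorProduct.singleAlgHom (R := R) (A := fun _ : Fin m => A) l a

/-- The substitution `X_l ↦ 1 ⊗ ⋯ ⊗ y ⊗ ⋯ ⊗ 1`. -/
def tensorEval {A : Type*} [CommRing A] [Algebra R A] (y : A) :
    MvPolynomial (Fin m) R →ₐ[R] ⨂[R] _ : Fin m, A :=
  aeval fun l => PiTensorProduct.singleAlgHom (R := R) (A := fun _ : Fin m => A) l y

theorem reindex_singleAlgHom {A : Type*} [Ring A] [Algebra R A] (σ : Equiv.Perm (Fin m))
    (l : Fin m) (a : A) :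
    PiTensorProduct.reindex R (fun _ => A) σ
      (PiTensorProduct.singleAlgHom (R := R) (A := fun _ : Fin m => A) l a) =
      PiTensorProduct.singleAlgHom (R := R) (A := fun _ : Fin m => A) (σ l) a := by
  simp only [PiTensorProduct.singleAlgHom_apply, PiTensorProduct.reindex_tprod]
  congr 1
  ext k
  simp only [MonoidHom.mulSingle_apply, Pi.mulSingle_apply, Equiv.symm_apply_eq]

theorem tensorTrace_mem {A : Type*} [Ring A] [Algebra R A] (a : A) :
    tensorTrace m a ∈ symPower R A m := by
  intro σ
  rw [tensorTrace, map_sum]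
  simp only [reindex_singleAlgHom]
  exact Equiv.sum_comp σ fun l =>
    PiTensorProduct.singleAlgHom (R := R) (A := fun _ : Fin m => A) l a

theorem reindex_tensorEval {A : Type*} [CommRing A] [Algebra R A] (y : A)
    (σ : Equiv.Perm (Fin m)) (Q : MvPolynomial (Fin m) R) :
    PiTensorProduct.reindex R (fun _ => A) σ (tensorEval m y Q) =
      tensorEval m y (rename σ Q) := by
  induction Q using MvPolynomial.induction_on with
  | C r =>
    rw [rename_C, tensorEval, aeval_C, Algebra.algebraMap_eq_smul_one, map_smul]
    congr 1
    rw [PiTensorProduct.one_def, PiTensorProduct.reindex_tprod]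
    rfl
  | add p q hp hq => simp only [map_add, hp, hq]
  | mul_X p l hp =>
    rw [map_mul, reindex_mul, hp, map_mul, map_mul]
    congr 1
    rw [rename_X, tensorEval, aeval_X, aeval_X, reindex_singleAlgHom]

/-- A pure tensor is a product of one-place tensors, and each of those is a polynomial in `y` in
that place. -/
theorem tensorEval_surjective {A : Type*} [CommRing A] [Algebra R A] {y : A}
    (hy : Algebra.adjoin R {y} = ⊤) : Function.Surjective (tensorEval (R := R) m y) := by
  rw [← AlgHom.range_eq_top, ← top_le_iff]
  have hsingle : ∀ (l : Fin m) (a : A),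
      PiTensorProduct.singleAlgHom (R := R) (A := fun _ : Fin m => A) l a ∈
        (tensorEval (R := R) m y).range := by
    intro l a
    have ha : a ∈ Algebra.adjoin R {y} := hy ▸ Algebra.mem_top
    have h : Algebra.adjoin R {y} ≤ (tensorEval (R := R) m y).range.comap
        (PiTensorProduct.singleAlgHom (R := R) (A := fun _ : Fin m => A) l) := by
      refine Algebra.adjoin_le (Set.singleton_subset_iff.mpr ?_)
      exact ⟨X l, by simp [tensorEval]⟩
    exact h ha
  rintro z -
  induction z using PiTensorProduct.induction_on with
  | add z z' hz hz' => exact add_mem hz hz'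
  | smul_tprod r f =>
    refine Subalgebra.smul_mem _ ?_ r
    have : f = ∏ l : Fin m, MonoidHom.mulSingle (fun _ : Fin m => A) l (f l) :=
      (Finset.univ_prod_mulSingle f).symm
    rw [this, PiTensorProduct.tprod_prod]
    exact prod_mem fun l _ => hsingle l (f l)

theorem tensorEval_psum {A : Type*} [CommRing A] [Algebra R A] (y : A) (k : ℕ) :
    tensorEval m y (psum (Fin m) R k) = tensorTrace m (y ^ k) := by
  simp [tensorEval, psum, tensorTrace, -PiTensorProduct.singleAlgHom_apply]

/-- Lift a symmetric tensor to a polynomial in `m` variables and average the lift over `𝔖_m`. The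
average is symmetric with the same image, so it is a polynomial in power sums, and these map to the
tensor traces. -/
theorem symPower_eq_adjoin_of_comm [Algebra ℚ R] {A : Type*} [CommRing A] [Algebra R A] {y : A}
    (hy : Algebra.adjoin R {y} = ⊤) :
    symPower R A m = Algebra.adjoin R (Set.range fun k : ℕ => tensorTrace m (y ^ k)) := by
  apply le_antisymm
  · intro z hz
    obtain ⟨Q, rfl⟩ := tensorEval_surjective m hy z
    let c : R := algebraMap ℚ R (Fintype.card (Equiv.Perm (Fin m)) : ℚ)⁻¹
    let Q' : MvPolynomial (Fin m) R := c • ∑ σ : Equiv.Perm (Fin m), rename σ Q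
    have hQ' : Q'.IsSymmetric := by
      intro τ
      rw [map_smul, map_sum]
      congr 1
      simp only [rename_rename]
      exact Equiv.sum_comp (Equiv.mulLeft τ) fun σ : Equiv.Perm (Fin m) => rename σ Q
    have hz' : tensorEval m y Q' = tensorEval m y Q := by
      have h : ∀ σ : Equiv.Perm (Fin m), tensorEval m y (rename σ Q) = tensorEval m y Q :=
        fun σ => by rw [← reindex_tensorEval, hz σ]
      rw [map_smul, map_sum, Finset.sum_congr rfl fun σ _ => h σ, Finset.sum_const,
        Finset.card_univ, ← Nat.cast_smul_eq_nsmul R, smul_smul]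
      rw [← map_natCast (algebraMap ℚ R), ← map_mul, inv_mul_cancel₀, map_one, one_smul]
      exact_mod_cast Fintype.card_ne_zero
    rw [← hz']
    have h : tensorEval m y Q' ∈
        (Algebra.adjoin R (Set.range (psum (Fin m) R))).map (tensorEval m y) :=
      ⟨Q', isSymmetric_mem_adjoin_psum hQ', rfl⟩
    rw [AlgHom.map_adjoin, ← Set.range_comp] at h
    refine Algebra.adjoin_mono ?_ h
    rintro _ ⟨k, rfl⟩
    exact ⟨k, (tensorEval_psum m y k).symm⟩
  · refine Algebra.adjoin_le ?_
    rintro _ ⟨k, rfl⟩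
    exact tensorTrace_mem m _

/-- Over a ring containing `ℚ`, the symmetric tensors on a commutative algebra generated by `y`
are generated by the power sums. -/
theorem symPower_eq_adjoin [Algebra ℚ R] {A : Type*} [inst : Ring A] [Algebra R A] {y : A}
    (hc : ∀ a b : A, a * b = b * a) (hy : Algebra.adjoin R {y} = ⊤) :
    symPower R A m = Algebra.adjoin R (Set.range fun k : ℕ => tensorTrace m (y ^ k)) := by
  -- The commutative structure extends the given ring instance, so the tensor power is the same
  -- object. The big algebra arrives only as a `Ring` with a proof of commutativity.
  let i : CommRing A := { inst with mul_comm := hc }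
  exact symPower_eq_adjoin_of_comm (A := A) m hy

/-- Multilinear expansion. Only spanning is used; uniqueness of the coefficients is not claimed. -/
theorem exists_tprod_pow_expansion {A : Type*} [Ring A] [Algebra R A] {y : A} {N : ℕ}
    (hy : Submodule.span R (Set.range fun j : Fin N => y ^ (j : ℕ)) = ⊤)
    (z : ⨂[R] _ : Fin m, A) :
    ∃ r : (Fin m → Fin N) → R,
      z = ∑ a, r a • PiTensorProduct.tprod R fun l => y ^ (a l : ℕ) := by
  induction z using PiTensorProduct.induction_on with
  | add z z' hz hz' =>
    obtain ⟨r, rfl⟩ := hz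
    obtain ⟨r', rfl⟩ := hz'
    exact ⟨r + r', by simp [add_smul, Finset.sum_add_distrib]⟩
  | smul_tprod s f =>
    have h : ∀ l, ∃ c : Fin N → R, ∑ j, c j • y ^ (j : ℕ) = f l := fun l =>
      (Submodule.mem_span_range_iff_exists_fun R).mp (hy ▸ Submodule.mem_top)
    choose c hc using h
    refine ⟨fun a => s * ∏ l, c l (a l), ?_⟩
    have hf : f = fun l => ∑ j, c l j • y ^ (j : ℕ) := funext fun l => (hc l).symm
    rw [hf, MultilinearMap.map_sum, Finset.smul_sum]
    refine Finset.sum_congr rfl fun a _ => ?_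
    rw [MultilinearMap.map_smul_univ, smul_smul]

end SymmetricTensors

/-! ### Second derivatives of determinants. -/

section DeterminantDerivatives

theorem derivation_prod {k S ι : Type*} [CommRing k] [CommRing S] [Algebra k S] [DecidableEq ι]
    (D : Derivation k S S) (s : Finset ι) (f : ι → S) :
    D (∏ c ∈ s, f c) = ∑ c ∈ s, (∏ c' ∈ s.erase c, f c') * D (f c) := by
  induction s using Finset.induction_on with
  | empty => simp
  | insert a s ha ih =>
    rw [Finset.prod_insert ha, D.leibniz, ih, Finset.sum_insert ha, Finset.erase_insert ha,
      smul_eq_mul, smul_eq_mul, Finset.mul_sum, add_comm]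
    congr 1
    refine Finset.sum_congr rfl fun c hc => ?_
    have hca : a ≠ c := fun h => ha (h ▸ hc)
    rw [Finset.erase_insert_of_ne hca,
      Finset.prod_insert (fun h => ha (Finset.mem_of_mem_erase h)), mul_assoc]

/-- The entries have constant derivatives, so the two derivations must hit distinct columns. The sum
runs over all pairs of columns, with zero on the diagonal, so that a later involution can act on the
whole index type. -/
theorem derivation_derivation_det {k S ι : Type*} [CommRing k] [CommRing S] [Algebra k S]
    [Fintype ι] [DecidableEq ι] (M : Matrix ι ι S) (u v u' v' : ι → k) (D E : Derivation k S S)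
    (hD : ∀ r c, D (M r c) = algebraMap k S (u r * v c))
    (hE : ∀ r c, E (M r c) = algebraMap k S (u' r * v' c)) :
    E (D M.det) = ∑ p : Equiv.Perm ι × ι × ι, if p.2.1 = p.2.2 then 0 else
      (Equiv.Perm.sign p.1 : ℤ) • ((∏ x ∈ (Finset.univ.erase p.2.1).erase p.2.2, M (p.1 x) x) *
        algebraMap k S (u (p.1 p.2.1) * v p.2.1 * (u' (p.1 p.2.2) * v' p.2.2))) := by
  rw [Matrix.det_apply, map_sum, map_sum, Fintype.sum_prod_type]
  refine Finset.sum_congr rfl fun σ _ => ?_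
  rw [Units.smul_def, map_zsmul, map_zsmul, derivation_prod, map_sum, Fintype.sum_prod_type,
    Finset.smul_sum]
  refine Finset.sum_congr rfl fun c _ => ?_
  rw [hD, E.leibniz, E.map_algebraMap, smul_zero, zero_add, derivation_prod, smul_eq_mul,
    Finset.mul_sum, Finset.smul_sum,
    ← Finset.add_sum_erase _ _ (Finset.mem_univ c), if_pos rfl, zero_add]
  refine Finset.sum_congr rfl fun c' hc' => ?_
  rw [if_neg (Finset.ne_of_mem_erase hc').symm, hE, map_mul (algebraMap k S) (u _ * v _)]
  congr 1
  ring

/-- Composing the permutation with the transposition of the two differentiated columns matches the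
terms of both sides, up to the sign of the transposition. -/
theorem derivation_derivation_det_antisymm {k S ι : Type*} [CommRing k] [CommRing S] [Algebra k S]
    [Fintype ι] [DecidableEq ι] (M : Matrix ι ι S) (u v u' v' : ι → k)
    (D E D' E' : Derivation k S S)
    (hD : ∀ r c, D (M r c) = algebraMap k S (u r * v c))
    (hE : ∀ r c, E (M r c) = algebraMap k S (u' r * v' c))
    (hD' : ∀ r c, D' (M r c) = algebraMap k S (u r * v' c))
    (hE' : ∀ r c, E' (M r c) = algebraMap k S (u' r * v c)) :
    E (D M.det) = -E' (D' M.det) := by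
  rw [derivation_derivation_det M u v u' v' D E hD hE,
    derivation_derivation_det M u v' u' v D' E' hD' hE', ← Finset.sum_neg_distrib]
  refine Finset.sum_nbij' (fun p => (p.1 * Equiv.swap p.2.1 p.2.2, p.2.2, p.2.1))
    (fun p => (p.1 * Equiv.swap p.2.1 p.2.2, p.2.2, p.2.1)) (by simp) (by simp) ?_ ?_ ?_
  · rintro ⟨σ, c, c'⟩ -
    simp [Equiv.swap_comm c' c, mul_assoc]
  · rintro ⟨σ, c, c'⟩ -
    simp [Equiv.swap_comm c' c, mul_assoc]
  · rintro ⟨σ, c, c'⟩ -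
    by_cases h : c = c'
    · simp [h]
    · have hprod : ∏ x ∈ (Finset.univ.erase c').erase c, M (σ (Equiv.swap c c' x)) x =
          ∏ x ∈ (Finset.univ.erase c).erase c', M (σ x) x := by
        rw [Finset.erase_right_comm]
        refine Finset.prod_congr rfl fun x hx => ?_
        rw [Finset.mem_erase, Finset.mem_erase] at hx
        rw [Equiv.swap_apply_of_ne_of_ne hx.2.1 hx.1]
      simp only [h, Ne.symm h, if_false, Equiv.Perm.mul_apply, Equiv.swap_apply_left,
        Equiv.swap_apply_right, Equiv.Perm.sign_mul, Equiv.Perm.sign_swap h]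
      rw [hprod, ← neg_smul]
      congr 1
      · simp
      · congr 2; ring

end DeterminantDerivatives

/-! ### Gradients of the invariants and the matrix form of `D`. -/

theorem pderiv_pderiv_minorSum {n : ℕ} (k : ℕ) (a b i j : Fin n) :
    pderiv (b, a) (pderiv (j, i) (minorSum n k)) =
      -pderiv (b, i) (pderiv (j, a) (minorSum n k)) := by
  simp only [minorSum, map_sum, ← Finset.sum_neg_distrib]
  refine Finset.sum_congr rfl fun s _ => ?_
  -- Each partial derivative of the entries is a constant rank-one matrix, the form required by the
  -- determinant lemma; it is zero when the variable lies outside the minor.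
  have h : ∀ (p q : Fin n) (r c : s), pderiv (p, q) (((genericMatrix n).submatrix
      (Subtype.val : s → Fin n) (Subtype.val : s → Fin n)) r c) =
      algebraMap ℂ (PolyGl n) ((if (r : Fin n) = p then 1 else 0) * if (c : Fin n) = q then 1 else 0) := by
    intro p q r c
    have hX : (genericMatrix n).submatrix (Subtype.val : s → Fin n) (Subtype.val : s → Fin n) r c =
        X ((r : Fin n), (c : Fin n)) := rfl
    rw [hX, pderiv_X]
    by_cases hr : (r : Fin n) = p <;> by_cases hc : (c : Fin n) = q <;>
      simp [hr, hc, Prod.ext_iff]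
  exact derivation_derivation_det_antisymm _ (fun r : s => if (r : Fin n) = j then (1 : ℂ) else 0)
    (fun c : s => if (c : Fin n) = i then (1 : ℂ) else 0)
    (fun r : s => if (r : Fin n) = b then (1 : ℂ) else 0)
    (fun c : s => if (c : Fin n) = a then (1 : ℂ) else 0) _ _ _ _ (h j i) (h b a) (h j a) (h b i)

/-- Square matrices of polynomial functions on `gl_n`. -/
abbrev PolyMat (n : ℕ) : Type := Matrix (Fin n) (Fin n) (PolyGl n)

instance (n : ℕ) : Algebra (InvRing n) (PolyGl n) :=
  inferInstanceAs (Algebra (invariantRing n) (PolyGl n))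

/-- The gradient of a polynomial function, with respect to the trace form. -/
def gradMat {n : ℕ} (f : PolyGl n) : PolyMat n := Matrix.of fun i j => pderiv (j, i) f

/-- The Kirillov--Wei operator of the vector representation, on polynomial matrices. -/
def matKW {n : ℕ} (Z : PolyMat n) : PolyMat n :=
  Matrix.of fun i l => ∑ j, pderiv (l, j) (Z i j)

/-- Antisymmetry of the derivatives of a polynomial matrix in the row indices. -/
def IsRowAntisymm {n : ℕ} (Z : PolyMat n) : Prop :=
  ∀ a b i j, pderiv (b, a) (Z i j) = -pderiv (b, i) (Z a j)

theorem isRowAntisymm_gradMat_minorSum (n k : ℕ) : IsRowAntisymm (gradMat (minorSum n k)) :=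
  fun a b i j => pderiv_pderiv_minorSum k a b i j

theorem pderiv_comm {σ R : Type*} [CommRing R] (i j : σ) (f : MvPolynomial σ R) :
    pderiv (R := R) i (pderiv j f) = pderiv j (pderiv i f) := by
  classical
  have h : ⁅pderiv (R := R) i, pderiv j⁆ = (0 : Derivation R (MvPolynomial σ R) (MvPolynomial σ R)) := by
    apply MvPolynomial.derivation_ext
    intro k
    rw [Derivation.commutator_apply, pderiv_X, pderiv_X]
    simp only [Pi.single_apply]
    split_ifs <;> simp
  have := DFunLike.congr_fun h f
  rwa [Derivation.commutator_apply, Derivation.zero_apply, sub_eq_zero] at this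

theorem IsRowAntisymm.matKW {n : ℕ} {Z : PolyMat n} (hZ : IsRowAntisymm Z) :
    IsRowAntisymm (matKW Z) := by
  intro a b i l
  simp only [BigAlg.matKW, Matrix.of_apply, map_sum, ← Finset.sum_neg_distrib]
  refine Finset.sum_congr rfl fun j _ => ?_
  rw [pderiv_comm, hZ a b i j, map_neg, pderiv_comm]

/-! ### The Kirillov–Wei operator on operators of the form `π(Z)`. -/

section Operators

variable {n : ℕ} {V : Type*} [AddCommGroup V] [Module ℂ V]

/-- The pure tensor `f ⊗ e`, as a polynomial map `gl_n → End V`. -/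
def tmulEnd (f : PolyGl n) (e : Module.End ℂ V) : PolyEnd n V := f ⊗ₜ[ℂ] e

theorem tmulEnd_mul (f f' : PolyGl n) (e e' : Module.End ℂ V) :
    tmulEnd f e * tmulEnd f' e' = tmulEnd (f * f') (e * e') :=
  Algebra.TensorProduct.tmul_mul_tmul f f' e e'

theorem add_tmulEnd (f f' : PolyGl n) (e : Module.End ℂ V) :
    tmulEnd (f + f') e = tmulEnd f e + tmulEnd f' e := TensorProduct.add_tmul f f' e

theorem tmulEnd_add (f : PolyGl n) (e e' : Module.End ℂ V) :
    tmulEnd f (e + e') = tmulEnd f e + tmulEnd f e' := TensorProduct.tmul_add f e e'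

theorem neg_tmulEnd (f : PolyGl n) (e : Module.End ℂ V) :
    tmulEnd (-f) e = -tmulEnd f e := TensorProduct.neg_tmul f e

theorem sum_tmulEnd {ι : Type*} (s : Finset ι) (f : ι → PolyGl n) (e : Module.End ℂ V) :
    tmulEnd (∑ i ∈ s, f i) e = ∑ i ∈ s, tmulEnd (f i) e := TensorProduct.sum_tmul s f e

theorem tmulEnd_zero (f : PolyGl n) : tmulEnd f (0 : Module.End ℂ V) = 0 :=
  TensorProduct.tmul_zero _ f

theorem smul_tmulEnd (r : InvRing n) (f : PolyGl n) (e : Module.End ℂ V) :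
    r • tmulEnd f e = tmulEnd (r • f) e := rfl

theorem algebraMap_polyEnd (r : InvRing n) :
    algebraMap (InvRing n) (PolyEnd n V) r = tmulEnd (r : invariantRing n).1 1 := rfl

variable (π : Matrix (Fin n) (Fin n) ℂ →ₗ⁅ℂ⁆ Module.End ℂ V)

theorem kirillovWei_tmulEnd (f : PolyGl n) (e : Module.End ℂ V) :
    kirillovWei π (tmulEnd f e) =
      ∑ a, ∑ b, tmulEnd (pderiv (b, a) f) (e * π (Matrix.single a b 1)) := by
  have h : ∀ g : PolyGl n ⊗[ℂ] Module.End ℂ V, kirillovWei π g = ∑ a : Fin n, ∑ b : Fin n,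
      TensorProduct.map (pderiv (b, a)).toLinearMap
        (LinearMap.mulRight ℂ (π (Matrix.single a b 1))) g := fun g => by
    simp only [← LinearMap.sum_apply]
    rfl
  exact h (f ⊗ₜ e)

/-- The polynomial map `∑ i j, Z_ij ⊗ π(E_ij)`. -/
def matOp : PolyMat n →ₗ[InvRing n] PolyEnd n V where
  toFun Z := ∑ i, ∑ j, tmulEnd (Z i j) (π (Matrix.single i j 1))
  map_add' Z Z' := by
    simp only [Matrix.add_apply, add_tmulEnd, Finset.sum_add_distrib]
  map_smul' r Z := by
    simp only [Matrix.smul_apply, Finset.smul_sum, smul_tmulEnd, RingHom.id_apply]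

theorem matOp_apply (Z : PolyMat n) :
    matOp π Z = ∑ i, ∑ j, tmulEnd (Z i j) (π (Matrix.single i j 1)) := rfl

theorem kirillovWei_scalar (f : PolyGl n) :
    kirillovWei π (tmulEnd f 1) = matOp π (gradMat f) := by
  simp only [kirillovWei_tmulEnd, one_mul, matOp_apply, gradMat, Matrix.of_apply]

/-- Split `π(E_ij)π(E_ab)` into a part `N` and the contraction `δ_ja π(E_ib)`. The contraction sums
to `π(matKW Z)`. The hypothesis `hπ` makes `N` symmetric under `i ↔ a`, whereas the coefficients are
antisymmetric, so the rest equals its own negative. -/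
theorem kirillovWei_matOp
    (hπ : ∀ i a j b, π (Matrix.single i j 1) * π (Matrix.single a b 1) -
        (if j = a then π (Matrix.single i b 1) else 0) =
      π (Matrix.single a j 1) * π (Matrix.single i b 1) -
        (if j = i then π (Matrix.single a b 1) else 0))
    {Z : PolyMat n} (hZ : IsRowAntisymm Z) :
    kirillovWei π (matOp π Z) = matOp π (matKW Z) := by
  set N : Fin n → Fin n → Fin n → Fin n → Module.End ℂ V := fun i a j b =>
    π (Matrix.single i j 1) * π (Matrix.single a b 1) -
        (if j = a then π (Matrix.single i b 1) else 0) with hN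
  set s : PolyEnd n V := ∑ i, ∑ j, ∑ a, ∑ b, tmulEnd (pderiv (b, a) (Z i j)) (N i a j b) with hs
  have h1 : kirillovWei π (matOp π Z) = s + matOp π (matKW Z) := by
    have h2 : matOp π (matKW Z) = ∑ i, ∑ j, ∑ a, ∑ b,
        tmulEnd (pderiv (b, a) (Z i j)) (if j = a then π (Matrix.single i b 1) else 0) := by
      rw [matOp_apply]
      refine Finset.sum_congr rfl fun i _ => ?_
      simp only [matKW, Matrix.of_apply, sum_tmulEnd]
      rw [Finset.sum_comm]
      refine Finset.sum_congr rfl fun j _ => ?_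
      refine Eq.trans ?_ (Finset.sum_eq_single j ?_ ?_).symm
      · simp
      · intro a _ ha
        simp [Ne.symm ha, tmulEnd_zero]
      · simp
    rw [h2, hs, matOp_apply]
    simp only [map_sum, kirillovWei_tmulEnd, ← Finset.sum_add_distrib, ← tmulEnd_add, hN,
      sub_add_cancel]
  have h2 : s = -s := by
    -- Reordering the sum interchanges the roles of `i` and `a` in the termwise comparison.
    have h3 : s = ∑ a, ∑ j, ∑ i, ∑ b, tmulEnd (pderiv (b, a) (Z i j)) (N i a j b) := by
      rw [hs, Finset.sum_comm]
      conv_rhs => rw [Finset.sum_comm]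
      refine Finset.sum_congr rfl fun j _ => ?_
      rw [Finset.sum_comm]
    conv_lhs => rw [h3]
    simp only [hs, ← Finset.sum_neg_distrib]
    refine Finset.sum_congr rfl fun i _ => Finset.sum_congr rfl fun j _ =>
      Finset.sum_congr rfl fun a _ => Finset.sum_congr rfl fun b _ => ?_
    rw [hZ i b a j, neg_tmulEnd]
    congr 2
    exact hπ a i j b
  have h3 : s = 0 := by
    have h4 : (2 : ℂ) • s = 0 := by
      rw [two_smul]
      nth_rewrite 1 [h2]
      exact neg_add_cancel s
    exact (smul_eq_zero.mp h4).resolve_left two_ne_zero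
  rw [h1, h3, zero_add]

end Operators

/-! ### Normal ordering on symmetric powers. -/

section SymPowRep

variable {n : ℕ} (m : ℕ)

theorem polyAct_single (i j : Fin n) (f : MvPolynomial (Fin n) ℂ) :
    polyAct (Matrix.single i j 1) f = X i * pderiv j f := by
  rw [polyAct_apply, Finset.sum_eq_single i, Finset.sum_eq_single j]
  · simp
  · intro b _ hb
    simp [hb.symm]
  · simp
  · intro a _ ha
    simp [ha.symm]
  · simp

theorem symPowRep_coe (A : Matrix (Fin n) (Fin n) ℂ) (f : homogeneousSubmodule (Fin n) ℂ m) :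
    ((symPowRep n m A f : homogeneousSubmodule (Fin n) ℂ m) : MvPolynomial (Fin n) ℂ) =
      polyAct A f := rfl

/-- The subtracted term is the commutator of `∂_j` with `x_a`, so what remains is normally ordered
and visibly symmetric in `i` and `a`. This is the property of symmetric powers on which the whole
argument rests. -/
theorem symPowRep_single_mul_single (i a j b : Fin n) (f : homogeneousSubmodule (Fin n) ℂ m) :
    (((symPowRep n m (Matrix.single i j 1) * symPowRep n m (Matrix.single a b 1) -
        (if j = a then symPowRep n m (Matrix.single i b 1) else 0)) f :
          homogeneousSubmodule (Fin n) ℂ m) : MvPolynomial (Fin n) ℂ) =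
      X i * X a * pderiv j (pderiv b (f : MvPolynomial (Fin n) ℂ)) := by
  rw [LinearMap.sub_apply, Module.End.mul_apply, Submodule.coe_sub, symPowRep_coe, symPowRep_coe,
    polyAct_single, polyAct_single, Derivation.leibniz, pderiv_X]
  by_cases h : j = a
  · subst h
    simp only [if_true, symPowRep_coe, polyAct_single, Pi.single_eq_same, smul_eq_mul]
    ring
  · simp only [if_neg h, LinearMap.zero_apply, ZeroMemClass.coe_zero,
      smul_eq_mul]
    have : (Pi.single j 1 : Fin n → MvPolynomial (Fin n) ℂ) a = 0 := by
      simp [Ne.symm h]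
    rw [this]; ring

theorem symPowRep_normalOrder (i a j b : Fin n) :
    symPowRep n m (Matrix.single i j 1) * symPowRep n m (Matrix.single a b 1) -
        (if j = a then symPowRep n m (Matrix.single i b 1) else 0) =
      symPowRep n m (Matrix.single a j 1) * symPowRep n m (Matrix.single i b 1) -
        (if j = i then symPowRep n m (Matrix.single a b 1) else 0) := by
  ext1 f
  apply Subtype.ext
  rw [symPowRep_single_mul_single, symPowRep_single_mul_single, mul_comm (X i)]

theorem bigGen_zero (p : ℕ) :
    bigGen (symPowRep n m) p 0 = tmulEnd (minorSum n p) 1 := rfl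

/-- The first `D` turns a scalar into `π` of a gradient; each further one acts as `matKW`, because
row antisymmetry persists. -/
theorem bigGen_succ (p q : ℕ) :
    bigGen (symPowRep n m) p (q + 1) =
      matOp (symPowRep n m) (matKW^[q] (gradMat (minorSum n (p + (q + 1))))) := by
  have hanti : ∀ (q k : ℕ), IsRowAntisymm (matKW^[q] (gradMat (minorSum n k))) := by
    intro q k
    induction q with
    | zero => exact isRowAntisymm_gradMat_minorSum n k
    | succ q ih => rw [Function.iterate_succ_apply']; exact ih.matKW
  have h : ∀ (q k : ℕ), (kirillovWei (symPowRep n m) ^ (q + 1)) (tmulEnd (minorSum n k) 1) =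
      matOp (symPowRep n m) (matKW^[q] (gradMat (minorSum n k))) := by
    intro q k
    induction q with
    | zero => rw [zero_add, pow_one, kirillovWei_scalar]; rfl
    | succ q ih =>
      rw [pow_succ', Module.End.mul_apply, ih,
        kirillovWei_matOp _ (symPowRep_normalOrder m) (hanti q k), Function.iterate_succ_apply']
  exact h q (p + (q + 1))

/-- Second derivatives vanish in degree one, so the normally ordered part is zero and the `π(E_ij)`
multiply like matrix units. -/
theorem matOp_symPowRep_one_mul (Z Z' : PolyMat n) :
    matOp (symPowRep n 1) Z * matOp (symPowRep n 1) Z' = matOp (symPowRep n 1) (Z * Z') := by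
  have h : ∀ i a j b : Fin n,
      symPowRep n 1 (Matrix.single i j 1) * symPowRep n 1 (Matrix.single a b 1) =
        if j = a then symPowRep n 1 (Matrix.single i b 1) else 0 := by
    intro i a j b
    rw [← sub_eq_zero]
    ext1 f
    apply Subtype.ext
    rw [symPowRep_single_mul_single]
    have h0 : (pderiv b (f : MvPolynomial (Fin n) ℂ)).IsHomogeneous 0 :=
      ((mem_homogeneousSubmodule _ _).mp f.2).pderiv
    rw [← totalDegree_zero_iff_isHomogeneous, totalDegree_eq_zero_iff_eq_C] at h0
    rw [h0, pderiv_C, mul_zero]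
    rfl
  simp only [matOp_apply, Finset.sum_mul]
  simp only [Finset.mul_sum, tmulEnd_mul, h, Matrix.mul_apply,
    sum_tmulEnd]
  refine Finset.sum_congr rfl fun i _ => ?_
  conv_rhs => rw [Finset.sum_comm]
  refine Finset.sum_congr rfl fun j _ => ?_
  refine Eq.trans (Finset.sum_eq_single j ?_ ?_) ?_
  · intro a _ ha
    simp [Ne.symm ha, tmulEnd_zero]
  · simp
  · simp

theorem matOp_symPowRep_one_one :
    matOp (symPowRep n 1) (1 : PolyMat n) = 1 := by
  have h : ∑ i : Fin n, symPowRep n 1 (Matrix.single i i 1) = 1 := by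
    ext1 f
    apply Subtype.ext
    rw [LinearMap.sum_apply, Submodule.coe_sum]
    simp only [symPowRep_coe, polyAct_single]
    -- Euler's identity: the identity matrix acts by the degree, here one.
    have := ((mem_homogeneousSubmodule _ _).mp f.2).sum_X_mul_pderiv
    simpa using this
  have h2 : (1 : PolyEnd n (homogeneousSubmodule (Fin n) ℂ 1)) = tmulEnd 1 1 := rfl
  have h3 : tmulEnd (n := n) 1 (∑ i : Fin n, symPowRep n 1 (Matrix.single i i 1)) =
      ∑ i : Fin n, tmulEnd 1 (symPowRep n 1 (Matrix.single i i 1)) :=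
    TensorProduct.tmul_sum _ _ _
  rw [h2, ← h, h3, matOp_apply]
  refine Finset.sum_congr rfl fun i _ => ?_
  rw [Finset.sum_eq_single i]
  · rw [Matrix.one_apply_eq]
  · intro j _ hj
    rw [Matrix.one_apply_ne hj.symm]
    exact TensorProduct.zero_tmul _ _
  · simp

end SymPowRep

/-! ### The span of the powers of the generic matrix. -/

section PolynomialMatrices

variable {n : ℕ}

/-- An invariant polynomial as a polynomial. -/
def toPoly (r : InvRing n) : PolyGl n := (r : invariantRing n).1

theorem toPoly_smul (r : InvRing n) (Z : PolyMat n) : toPoly r • Z = r • Z := rfl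

theorem toPoly_mem (r : InvRing n) : toPoly r ∈ invariantRing n := (r : invariantRing n).2

theorem smul_mem_of_mem_invariantRing (W : Submodule (InvRing n) (PolyMat n)) {f : PolyGl n}
    (hf : f ∈ invariantRing n) {Z : PolyMat n} (hZ : Z ∈ W) : f • Z ∈ W :=
  W.smul_mem (show InvRing n from (⟨f, hf⟩ : invariantRing n)) hZ

theorem complex_smul_mem (W : Submodule (InvRing n) (PolyMat n)) (c : ℂ) {Z : PolyMat n}
    (hZ : Z ∈ W) : c • Z ∈ W := by
  have h := smul_mem_of_mem_invariantRing W ((invariantRing n).algebraMap_mem c) hZ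
  rwa [algebraMap_smul] at h

theorem gradMat_add (f g : PolyGl n) : gradMat (f + g) = gradMat f + gradMat g := by
  ext1 i j; simp [gradMat]

theorem gradMat_mul (f g : PolyGl n) : gradMat (f * g) = f • gradMat g + g • gradMat f := by
  ext1 i j; simp [gradMat]

theorem gradMat_smul (c : ℂ) (f : PolyGl n) : gradMat (c • f) = c • gradMat f := by
  ext1 i j; simp [gradMat]

theorem gradMat_sum {ι : Type*} (s : Finset ι) (f : ι → PolyGl n) :
    gradMat (∑ i ∈ s, f i) = ∑ i ∈ s, gradMat (f i) := by
  ext1 i j; simp [gradMat, Matrix.sum_apply]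

theorem gradMat_C (c : ℂ) : gradMat (C c : PolyGl n) = 0 := by
  ext1 i j; simp [gradMat]

theorem matKW_add (Z Z' : PolyMat n) : matKW (Z + Z') = matKW Z + matKW Z' := by
  ext1 i j; simp [matKW, Finset.sum_add_distrib]

theorem matKW_smul (f : PolyGl n) (Z : PolyMat n) :
    matKW (f • Z) = f • matKW Z + Z * gradMat f := by
  ext1 i l
  simp [matKW, gradMat, Finset.sum_add_distrib, Matrix.mul_apply, Finset.mul_sum]

theorem matKW_one : matKW (1 : PolyMat n) = 0 := by
  ext1 i l
  change ∑ j, pderiv (l, j) ((1 : PolyMat n) i j) = 0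
  refine Finset.sum_eq_zero fun j _ => ?_
  rw [Matrix.one_apply]
  split_ifs <;> simp

theorem pderiv_genericMatrix (a b i j : Fin n) :
    pderiv (a, b) (genericMatrix n i j) = if i = a ∧ j = b then 1 else 0 := by
  have hX : genericMatrix n i j = X (i, j) := rfl
  rw [hX, pderiv_X, Pi.single_apply]
  simp only [Prod.ext_iff, eq_comm]

/-- Leibniz rule: differentiating the factor `Y` contributes the trace term. -/
theorem matKW_generic_mul (Z : PolyMat n) :
    matKW (genericMatrix n * Z) = Z.trace • (1 : PolyMat n) + genericMatrix n * matKW Z := by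
  ext1 i l
  have h : ∀ j, pderiv (l, j) ((genericMatrix n * Z) i j) =
      (if i = l then Z j j else 0) + ∑ k, genericMatrix n i k * pderiv (l, j) (Z k j) := by
    intro j
    rw [Matrix.mul_apply, map_sum]
    simp only [Derivation.leibniz, pderiv_genericMatrix, smul_eq_mul, Finset.sum_add_distrib]
    rw [add_comm]
    congr 1
    by_cases hil : i = l <;> simp [hil]
  change ∑ j, pderiv (l, j) ((genericMatrix n * Z) i j) = _
  rw [Finset.sum_congr rfl fun j _ => h j, Finset.sum_add_distrib, Matrix.add_apply]
  congr 1
  · by_cases hil : i = l <;> simp [hil, Matrix.trace]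
  · rw [Matrix.mul_apply, Finset.sum_comm]
    simp only [matKW, Matrix.of_apply, Finset.mul_sum]

theorem trace_pow_mem (k : ℕ) : (genericMatrix n ^ k).trace ∈ invariantRing n := by
  rw [mem_invariantRing]
  intro g
  have hev : ∀ A : Matrix (Fin n) (Fin n) ℂ,
      evalAt A (genericMatrix n ^ k).trace = (A ^ k).trace := by
    intro A
    rw [AddMonoidHom.map_trace, ← AlgHom.mapMatrix_apply, map_pow, AlgHom.mapMatrix_apply,
      evalAt_generic]
  apply MvPolynomial.funext
  intro a
  rw [eval_eq_evalAt, eval_eq_evalAt, evalAt_adSubst, hev, hev, Matrix.coe_units_inv]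
  generalize (Matrix.of fun i j => a (i, j) : Matrix (Fin n) (Fin n) ℂ) = A
  rw [← Matrix.coe_units_inv, Units.conj_pow, Matrix.trace_units_conj]

theorem diagRestr_trace_pow (k : ℕ) :
    diagRestr n (genericMatrix n ^ k).trace = psum (Fin n) ℂ k := by
  have h : (diagRestr n).mapMatrix (genericMatrix n) = Matrix.diagonal fun i : Fin n => X i := by
    ext1 i j
    have hX : genericMatrix n i j = X (i, j) := rfl
    rw [AlgHom.mapMatrix_apply, Matrix.map_apply, hX, diagRestr, aeval_X, Matrix.diagonal_apply]
  rw [AddMonoidHom.map_trace, ← AlgHom.mapMatrix_apply, map_pow, h, Matrix.diagonal_pow,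
    Matrix.trace_diagonal]
  rfl

/-- Newton's identities for the invariant polynomials `c_k` and `tr Y^k`. -/
theorem mul_minorSum_eq_sum {k : ℕ} (hk : k ≤ n) :
    (k : PolyGl n) * minorSum n k = (-1) ^ (k + 1) *
      ∑ a ∈ Finset.HasAntidiagonal.antidiagonal k with a.1 < k,
        (-1) ^ a.1 * minorSum n a.1 * (genericMatrix n ^ a.2).trace := by
  rw [← sub_eq_zero]
  -- An invariant is determined by its restriction to diagonal matrices, where the identity is
  -- Newton's for symmetric polynomials.
  apply eq_zero_of_diagRestr
  · refine sub_mem (mul_mem (natCast_mem _ _) (minorSum_mem k hk))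
      (mul_mem (pow_mem (neg_mem (one_mem _)) _) (sum_mem fun a ha => ?_))
    exact mul_mem (mul_mem (pow_mem (neg_mem (one_mem _)) _)
      (minorSum_mem _ ((Finset.mem_filter.mp ha).2.le.trans hk))) (trace_pow_mem _)
  · simp only [map_sub, map_mul, map_natCast, map_pow, map_neg, map_one, map_sum,
      diagRestr_minorSum, diagRestr_trace_pow]
    rw [mul_esymm_eq_sum, sub_self]

/-- Cyclicity of the trace makes every factor contribute equally. The extra factor `Y^a` makes the
induction close; the gradient of `tr Y^(k+1)` uses only `a = 0`. -/
theorem trace_pow_mul_derivation (D : Derivation ℂ (PolyGl n) (PolyGl n)) (k : ℕ) : ∀ a : ℕ,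
    (genericMatrix n ^ a * (genericMatrix n ^ (k + 1)).map D).trace =
      (k + 1 : ℂ) • (genericMatrix n ^ (a + k) * (genericMatrix n).map D).trace := by
  have hmul : ∀ M N : PolyMat n, (M * N).map D = M.map D * N + M * N.map D := by
    intro M N
    ext1 i j
    simp only [Matrix.map_apply, Matrix.mul_apply, map_sum, Derivation.leibniz, smul_eq_mul,
      Matrix.add_apply, Finset.sum_add_distrib]
    rw [add_comm]
    congr 1
    exact Finset.sum_congr rfl fun _ _ => mul_comm _ _
  induction k with
  | zero => intro a; simp
  | succ k ih =>
    intro a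
    have h1 : (genericMatrix n ^ a * ((genericMatrix n).map D * genericMatrix n ^ (k + 1))).trace =
        (genericMatrix n ^ (a + (k + 1)) * (genericMatrix n).map D).trace := by
      rw [← mul_assoc, Matrix.trace_mul_comm, ← mul_assoc, ← pow_add, add_comm]
    rw [pow_succ' _ (k + 1), hmul, mul_add, Matrix.trace_add, h1, ← mul_assoc _ (genericMatrix n),
      ← pow_succ, ih (a + 1), add_right_comm a 1 k, add_assoc a k 1, Nat.cast_succ,
      add_smul ((k : ℂ) + 1) (1 : ℂ), one_smul, add_comm]

theorem gradMat_trace_pow (k : ℕ) :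
    gradMat (genericMatrix n ^ (k + 1)).trace = (k + 1 : ℂ) • genericMatrix n ^ k := by
  ext1 i j
  have h := trace_pow_mul_derivation (n := n) (pderiv (j, i)) k 0
  have hY : (genericMatrix n).map (pderiv (j, i)) = Matrix.single j i 1 := by
    ext1 a b
    rw [Matrix.map_apply, pderiv_genericMatrix, Matrix.single_apply]
    simp only [eq_comm]
  rw [hY, pow_zero, one_mul, zero_add, Matrix.trace_mul_single, MulOpposite.op_one, one_smul] at h
  rw [Matrix.smul_apply, ← h, gradMat, Matrix.of_apply, AddMonoidHom.map_trace]

/-- The span of the powers of the generic matrix over the invariant polynomials. -/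
def powSpan (n : ℕ) : Submodule (InvRing n) (PolyMat n) :=
  Submodule.span _ (Set.range fun k : ℕ => genericMatrix n ^ k)

theorem pow_mem_powSpan (k : ℕ) : genericMatrix n ^ k ∈ powSpan n :=
  Submodule.subset_span ⟨k, rfl⟩

theorem powSpan_eq_adjoin :
    powSpan n = (Algebra.adjoin (InvRing n) {genericMatrix n}).toSubmodule := by
  rw [Algebra.adjoin_eq_span, powSpan]
  congr 1
  ext Z
  simp [Submonoid.mem_closure_singleton]

theorem mul_mem_powSpan {Z Z' : PolyMat n} (hZ : Z ∈ powSpan n) (hZ' : Z' ∈ powSpan n) :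
    Z * Z' ∈ powSpan n := by
  rw [powSpan_eq_adjoin, Subalgebra.mem_toSubmodule] at *
  exact mul_mem hZ hZ'

/-- The gradients of the `c_k` and the powers of `Y` are expressed through each other. -/
theorem gradMat_minorSum_newton {k : ℕ} (hk : k + 1 ≤ n) :
    ((k + 1 : ℕ) : ℂ) • gradMat (minorSum n (k + 1)) = (-1 : ℂ) ^ (k + 2) •
      ∑ a ∈ Finset.range (k + 1), (-1 : ℂ) ^ a •
        (minorSum n a • ((k - a : ℕ) + 1 : ℂ) • genericMatrix n ^ (k - a) +
          (genericMatrix n ^ (k - a + 1)).trace • gradMat (minorSum n a)) := by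
  have h1 : ((k + 1 : ℕ) : ℂ) • minorSum n (k + 1) = (-1 : ℂ) ^ (k + 2) •
      ∑ a ∈ Finset.range (k + 1), (-1 : ℂ) ^ a •
        (minorSum n a * (genericMatrix n ^ (k - a + 1)).trace) := by
    have h := mul_minorSum_eq_sum hk
    rw [Finset.sum_filter, Finset.Nat.sum_antidiagonal_eq_sum_range_succ_mk,
      Finset.sum_range_succ, if_neg (lt_irrefl _), add_zero] at h
    simp only [Algebra.smul_def, map_pow, map_neg, map_one, map_natCast]
    rw [h]
    congr 1
    refine Finset.sum_congr rfl fun a ha => ?_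
    have ha' := Finset.mem_range.mp ha
    rw [if_pos ha', mul_assoc, Nat.sub_add_comm (Nat.lt_succ_iff.mp ha')]
  rw [← gradMat_smul, h1, gradMat_smul, gradMat_sum]
  congr 1
  refine Finset.sum_congr rfl fun a _ => ?_
  rw [gradMat_smul, gradMat_mul, gradMat_trace_pow]

theorem gradMat_minorSum_zero : gradMat (minorSum n 0) = 0 := by
  have h : minorSum n 0 = C 1 := by simp [minorSum]
  rw [h, gradMat_C]

theorem gradMat_minorSum_mem {k : ℕ} (hk : k ≤ n) : gradMat (minorSum n k) ∈ powSpan n := by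
  induction k using Nat.strong_induction_on with
  | _ k ih =>
    rcases k with _ | k
    · rw [gradMat_minorSum_zero]; exact zero_mem _
    · have hk0 : ((k + 1 : ℕ) : ℂ) ≠ 0 := Nat.cast_ne_zero.mpr k.succ_ne_zero
      rw [← inv_smul_smul₀ hk0 (gradMat _), gradMat_minorSum_newton hk]
      refine complex_smul_mem _ _ (complex_smul_mem _ _ (sum_mem fun a ha => ?_))
      have ha' := Finset.mem_range.mp ha
      refine complex_smul_mem _ _ (add_mem ?_ ?_)
      · exact smul_mem_of_mem_invariantRing _ (minorSum_mem a (by omega))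
          (complex_smul_mem _ _ (pow_mem_powSpan _))
      · exact smul_mem_of_mem_invariantRing _ (trace_pow_mem _) (ih a ha' (by omega))

/-- In the differentiated Newton identity, `Y^k` occurs only in the term `a = 0`, with coefficient
`±(k+1)` since `c_0 = 1`. All other terms are gradients or lower powers. -/
theorem pow_mem_span_gradMat {k : ℕ} (hk : k < n) : genericMatrix n ^ k ∈
    Submodule.span (InvRing n) (Set.range fun j : Fin n => gradMat (minorSum n (j + 1))) := by
  induction k using Nat.strong_induction_on with
  | _ k ih =>
    set W := Submodule.span (InvRing n)
      (Set.range fun j : Fin n => gradMat (minorSum n (j + 1))) with hW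
    have hgrad : ∀ a ≤ n, gradMat (minorSum n a) ∈ W := by
      intro a ha
      rcases a with _ | a
      · rw [gradMat_minorSum_zero]; exact zero_mem _
      · exact Submodule.subset_span ⟨⟨a, ha⟩, rfl⟩
    have h := gradMat_minorSum_newton (n := n) (k := k) hk
    have h0 : minorSum n 0 = 1 := by simp [minorSum]
    rw [Finset.sum_range_succ', smul_add, ← sub_eq_iff_eq_add'] at h
    rw [gradMat_minorSum_zero, smul_zero, add_zero, h0, one_smul, Nat.sub_zero, smul_smul,
      smul_smul] at h
    have hc : (-1 : ℂ) ^ (k + 2) * (-1) ^ 0 * ((k : ℂ) + 1) ≠ 0 := by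
      refine mul_ne_zero (by simp) (by exact_mod_cast k.succ_ne_zero)
    rw [← inv_smul_smul₀ hc (genericMatrix n ^ k), ← h]
    refine complex_smul_mem _ _ (sub_mem (complex_smul_mem _ _ (hgrad _ hk))
      (complex_smul_mem _ _ (sum_mem fun a ha => complex_smul_mem _ _ (add_mem ?_ ?_))))
    · have ha' := Finset.mem_range.mp ha
      exact smul_mem_of_mem_invariantRing _ (minorSum_mem _ (by omega))
        (complex_smul_mem _ _ (ih _ (by omega) (by omega)))
    · have ha' := Finset.mem_range.mp ha
      exact smul_mem_of_mem_invariantRing _ (trace_pow_mem _) (hgrad _ (by omega))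

/-- The `c_k` generate the invariants and the gradient obeys the Leibniz rule. This is needed
because `matKW` is not `R`-linear: it differentiates coefficients. -/
theorem gradMat_mem {f : PolyGl n} (hf : f ∈ invariantRing n) : gradMat f ∈ powSpan n := by
  have h := invariant_mem_adjoin hf
  clear hf
  have key : f ∈ invariantRing n ∧ gradMat f ∈ powSpan n := by
    induction h using Algebra.adjoin_induction with
    | mem f hf =>
      obtain ⟨k, hk, rfl⟩ := hf
      exact ⟨minorSum_mem k hk, gradMat_minorSum_mem hk⟩
    | algebraMap c =>
      exact ⟨(invariantRing n).algebraMap_mem c, (gradMat_C (n := n) c).symm ▸ zero_mem _⟩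
    | add f g _ _ hf hg =>
      exact ⟨add_mem hf.1 hg.1, gradMat_add f g ▸ add_mem hf.2 hg.2⟩
    | mul f g _ _ hf hg =>
      refine ⟨mul_mem hf.1 hg.1, gradMat_mul f g ▸ add_mem ?_ ?_⟩
      · exact smul_mem_of_mem_invariantRing _ hf.1 hg.2
      · exact smul_mem_of_mem_invariantRing _ hg.1 hf.2
  exact key.2

theorem matKW_mem {Z : PolyMat n} (hZ : Z ∈ powSpan n) : matKW Z ∈ powSpan n := by
  have hpow : ∀ k, matKW (genericMatrix n ^ k) ∈ powSpan n := by
    intro k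
    induction k with
    | zero => rw [pow_zero, matKW_one]; exact zero_mem _
    | succ k ih =>
      rw [pow_succ', matKW_generic_mul]
      refine add_mem (smul_mem_of_mem_invariantRing _ (trace_pow_mem k) ?_)
        (mul_mem_powSpan ?_ ih)
      · simpa using pow_mem_powSpan (n := n) 0
      · simpa using pow_mem_powSpan (n := n) 1
  -- Membership of `Z` is carried along for the term `Z * gradMat r` that arises from a coefficient
  -- `r`.
  have h : ∀ Z ∈ powSpan n, Z ∈ powSpan n ∧ matKW Z ∈ powSpan n := by
    intro Z hZ
    rw [powSpan] at hZ
    induction hZ using Submodule.span_induction with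
    | mem Z hZ =>
      obtain ⟨k, rfl⟩ := hZ
      exact ⟨pow_mem_powSpan k, hpow k⟩
    | zero =>
      refine ⟨zero_mem _, ?_⟩
      have h0 : matKW (0 : PolyMat n) = 0 := by ext1 i j; simp [matKW]
      rw [h0]
      exact zero_mem _
    | add Z Z' _ _ h h' => exact ⟨add_mem h.1 h'.1, matKW_add Z Z' ▸ add_mem h.2 h'.2⟩
    | smul r Z _ h =>
      refine ⟨Submodule.smul_mem _ r h.1, ?_⟩
      rw [← toPoly_smul, matKW_smul]
      exact add_mem (smul_mem_of_mem_invariantRing _ (toPoly_mem r) h.2)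
        (mul_mem_powSpan h.1 (gradMat_mem (toPoly_mem r)))
  exact (h Z hZ).2

theorem charpoly_coeff_mem (i : ℕ) : (genericMatrix n).charpoly.coeff i ∈ invariantRing n := by
  by_cases hi : i ≤ n
  · have h := minorSum_eq n (n - i) (Nat.sub_le _ _)
    rw [Nat.sub_sub_self hi] at h
    have h2 : (genericMatrix n).charpoly.coeff i = (-1) ^ (n - i) * minorSum n (n - i) := by
      rw [h, ← mul_assoc, ← mul_pow]
      simp
    rw [h2]
    exact mul_mem (pow_mem (neg_mem (one_mem _)) _) (minorSum_mem _ (Nat.sub_le _ _))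
  · rw [Polynomial.coeff_eq_zero_of_natDegree_lt]
    · exact zero_mem _
    · rw [Matrix.charpoly_natDegree_eq_dim, Fintype.card_fin]
      omega

/-- Cayley–Hamilton, whose coefficients are invariant. -/
theorem powSpan_eq_span_fin : powSpan n =
    Submodule.span (InvRing n) (Set.range fun j : Fin n => genericMatrix n ^ (j : ℕ)) := by
  set U := Submodule.span (InvRing n) (Set.range fun j : Fin n => genericMatrix n ^ (j : ℕ))
    with hU
  have hlt : ∀ k < n, genericMatrix n ^ k ∈ U := fun k hk => Submodule.subset_span ⟨⟨k, hk⟩, rfl⟩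
  have hCH : genericMatrix n ^ n ∈ U := by
    have h := Matrix.aeval_self_charpoly (genericMatrix n)
    have hdeg : (genericMatrix n).charpoly.natDegree = n := by
      rw [Matrix.charpoly_natDegree_eq_dim, Fintype.card_fin]
    have hlead : (genericMatrix n).charpoly.coeff n = 1 := by
      have h1 := (Matrix.charpoly_monic (genericMatrix n)).coeff_natDegree
      rwa [hdeg] at h1
    rw [Polynomial.aeval_eq_sum_range, hdeg, Finset.sum_range_succ, hlead, one_smul,
      add_comm, add_eq_zero_iff_eq_neg] at h
    rw [h]
    refine neg_mem (sum_mem fun i hi => ?_)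
    exact smul_mem_of_mem_invariantRing _ (charpoly_coeff_mem i) (hlt i (Finset.mem_range.mp hi))
  have hmul : ∀ Z ∈ U, genericMatrix n * Z ∈ U := by
    intro Z hZ
    rw [hU] at hZ
    induction hZ using Submodule.span_induction with
    | mem Z hZ =>
      obtain ⟨j, rfl⟩ := hZ
      change genericMatrix n * genericMatrix n ^ (j : ℕ) ∈ U
      rw [← pow_succ']
      rcases (Nat.succ_le_of_lt j.2).lt_or_eq with hj | hj
      · exact hlt _ hj
      · rw [← Nat.succ_eq_add_one, hj]; exact hCH
    | zero => rw [mul_zero]; exact zero_mem _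
    | add Z Z' _ _ h h' => rw [mul_add]; exact add_mem h h'
    | smul r Z _ h => rw [mul_smul_comm]; exact Submodule.smul_mem _ _ h
  apply le_antisymm
  · refine Submodule.span_le.mpr ?_
    rintro _ ⟨k, rfl⟩
    change genericMatrix n ^ k ∈ U
    induction k with
    | zero =>
      -- For `n = 0` no exponent is below `n`, and `Y^0` is the power covered by Cayley–Hamilton.
      rcases Nat.eq_zero_or_pos n with h | h
      · subst h; exact hCH
      · exact hlt 0 h
    | succ k ih => rw [pow_succ']; exact hmul _ ih
  · refine Submodule.span_le.mpr ?_
    rintro _ ⟨k, rfl⟩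
    exact pow_mem_powSpan _

end PolynomialMatrices

/-! ### Generators of the big algebras. -/

section Generators

variable {n : ℕ} (m : ℕ)

/-- The big algebra of `S^m(ℂ^n)` is generated by the operators `π(Y^k)`. -/
theorem bigAlgebra_symPowRep_eq_adjoin :
    bigAlgebra (symPowRep n m) = Algebra.adjoin (InvRing n)
      (Set.range fun k : ℕ => matOp (symPowRep n m) (genericMatrix n ^ k)) := by
  apply le_antisymm
  · have hmat : ∀ Z ∈ powSpan n, matOp (symPowRep n m) Z ∈ Algebra.adjoin (InvRing n)
        (Set.range fun k : ℕ => matOp (symPowRep n m) (genericMatrix n ^ k)) := by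
      have h : powSpan n ≤ (Algebra.adjoin (InvRing n) (Set.range fun k : ℕ =>
          matOp (symPowRep n m) (genericMatrix n ^ k))).toSubmodule.comap
            (matOp (symPowRep n m)) := by
        refine Submodule.span_le.mpr ?_
        rintro _ ⟨k, rfl⟩
        exact Algebra.subset_adjoin ⟨k, rfl⟩
      exact fun Z hZ => h hZ
    intro F hF
    have hF' : F ∈ bigAlgebraComplex (symPowRep n m) := hF
    clear hF
    rw [bigAlgebraComplex] at hF'
    induction hF' using Algebra.adjoin_induction with
    | mem F hF =>
      obtain ⟨p, q, hpq, rfl⟩ := hF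
      rcases q with _ | q
      · rw [bigGen_zero]
        exact Subalgebra.algebraMap_mem _
          (show InvRing n from (⟨minorSum n p, minorSum_mem p hpq⟩ : invariantRing n))
      · rw [bigGen_succ]
        apply hmat
        have h : ∀ q k, k ≤ n → matKW^[q] (gradMat (minorSum n k)) ∈ powSpan n := by
          intro q k hk
          induction q with
          | zero => exact gradMat_minorSum_mem hk
          | succ q ih => rw [Function.iterate_succ_apply']; exact matKW_mem ih
        exact h q _ hpq
    | algebraMap c => exact Subalgebra.algebraMap_mem _ (algebraMap ℂ (InvRing n) c)
    | add F G _ _ hF hG => exact add_mem hF hG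
    | mul F G _ _ hF hG => exact mul_mem hF hG
  · refine Algebra.adjoin_le ?_
    rintro _ ⟨k, rfl⟩
    -- The generators with `q = 1` already suffice to produce every `π(Y^k)`.
    have hgrad : ∀ j : Fin n, matOp (symPowRep n m) (gradMat (minorSum n (j + 1))) ∈
        bigAlgebra (symPowRep n m) := by
      intro j
      have h : bigGen (symPowRep n m) j 1 ∈ bigAlgebraComplex (symPowRep n m) :=
        Algebra.subset_adjoin ⟨j, 1, j.2, rfl⟩
      rw [bigGen_succ] at h
      exact h
    have hle : powSpan n ≤ (bigAlgebra (symPowRep n m)).toSubmodule.comap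
        (matOp (symPowRep n m)) := by
      rw [powSpan_eq_span_fin, Submodule.span_le]
      rintro _ ⟨j, rfl⟩
      have h2 : Submodule.span (InvRing n) (Set.range fun j : Fin n =>
          gradMat (minorSum n (j + 1))) ≤ (bigAlgebra (symPowRep n m)).toSubmodule.comap
            (matOp (symPowRep n m)) := by
        rw [Submodule.span_le]
        rintro _ ⟨j, rfl⟩
        exact hgrad j
      exact h2 (pow_mem_span_gradMat j.2)
    exact hle (pow_mem_powSpan k)

variable (n)

/-- The generic matrix, as an element of the big algebra of the vector representation. -/
def vecGen : bigAlgebra (symPowRep n 1) :=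
  ⟨matOp (symPowRep n 1) (genericMatrix n), by
    rw [bigAlgebra_symPowRep_eq_adjoin]
    exact Algebra.subset_adjoin ⟨1, by simp only [pow_one]⟩⟩

theorem coe_vecGen_pow (k : ℕ) :
    ((vecGen n ^ k : bigAlgebra (symPowRep n 1)) :
      PolyEnd n (homogeneousSubmodule (Fin n) ℂ 1)) =
      matOp (symPowRep n 1) (genericMatrix n ^ k) := by
  induction k with
  | zero => rw [pow_zero, pow_zero, matOp_symPowRep_one_one]; rfl
  | succ k ih =>
    rw [pow_succ, pow_succ, ← matOp_symPowRep_one_mul, ← ih]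
    rfl

/-- For `m = 1`, `π` is multiplicative and unital, so the image of the span of powers is already a
subalgebra and exhausts the big algebra; Cayley–Hamilton bounds the exponents. -/
theorem span_vecGen_pow : Submodule.span (InvRing n)
    (Set.range fun j : Fin n => vecGen n ^ (j : ℕ)) = ⊤ := by
  set B := bigAlgebra (symPowRep n 1) with hB
  have hmem : ∀ Z ∈ powSpan n, matOp (symPowRep n 1) Z ∈
      (Submodule.span (InvRing n) (Set.range fun j : Fin n => vecGen n ^ (j : ℕ))).map
        B.val.toLinearMap := by
    have h : powSpan n ≤ ((Submodule.span (InvRing n)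
        (Set.range fun j : Fin n => vecGen n ^ (j : ℕ))).map B.val.toLinearMap).comap
          (matOp (symPowRep n 1)) := by
      rw [powSpan_eq_span_fin, Submodule.span_le]
      rintro _ ⟨j, rfl⟩
      exact ⟨vecGen n ^ (j : ℕ), Submodule.subset_span ⟨j, rfl⟩, coe_vecGen_pow n j⟩
    exact fun Z hZ => h hZ
  have hB2 : ∀ F ∈ B, ∃ Z ∈ powSpan n, matOp (symPowRep n 1) Z = F := by
    intro F hF
    rw [hB, bigAlgebra_symPowRep_eq_adjoin] at hF
    have hone : (1 : PolyMat n) ∈ powSpan n := by simpa using pow_mem_powSpan (n := n) 0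
    induction hF using Algebra.adjoin_induction with
    | mem F hF =>
      obtain ⟨k, rfl⟩ := hF
      exact ⟨_, pow_mem_powSpan k, rfl⟩
    | algebraMap r =>
      refine ⟨r • 1, Submodule.smul_mem _ r hone, ?_⟩
      rw [map_smul, matOp_symPowRep_one_one, Algebra.algebraMap_eq_smul_one]
    | add F G _ _ hF hG =>
      obtain ⟨Z, hZ, rfl⟩ := hF
      obtain ⟨Z', hZ', rfl⟩ := hG
      exact ⟨Z + Z', add_mem hZ hZ', map_add _ _ _⟩
    | mul F G _ _ hF hG =>
      obtain ⟨Z, hZ, rfl⟩ := hF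
      obtain ⟨Z', hZ', rfl⟩ := hG
      exact ⟨Z * Z', mul_mem_powSpan hZ hZ', (matOp_symPowRep_one_mul Z Z').symm⟩
  rw [eq_top_iff]
  rintro ⟨F, hF⟩ -
  obtain ⟨Z, hZ, rfl⟩ := hB2 F hF
  obtain ⟨x, hx, hxe⟩ := hmem Z hZ
  have hx' : x = ⟨matOp (symPowRep n 1) Z, hF⟩ := Subtype.ext hxe
  exact hx' ▸ hx

theorem adjoin_vecGen : Algebra.adjoin (InvRing n) {vecGen n} = ⊤ := by
  rw [eq_top_iff]
  intro a _
  have h : Submodule.span (InvRing n) (Set.range fun j : Fin n => vecGen n ^ (j : ℕ)) ≤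
      (Algebra.adjoin (InvRing n) {vecGen n}).toSubmodule := by
    rw [Submodule.span_le]
    rintro _ ⟨j, rfl⟩
    exact pow_mem (Algebra.self_mem_adjoin_singleton _ _) _
  exact h (span_vecGen_pow n ▸ Submodule.mem_top)

theorem bigAlgebra_vec_mul_comm (a b : bigAlgebra (symPowRep n 1)) : a * b = b * a := by
  have h : ∀ c : bigAlgebra (symPowRep n 1), ∃ P : Polynomial (InvRing n),
      Polynomial.aeval (vecGen n) P = c := by
    intro c
    have hc : c ∈ Algebra.adjoin (InvRing n) {vecGen n} := adjoin_vecGen n ▸ Algebra.mem_top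
    rw [Algebra.adjoin_singleton_eq_range_aeval] at hc
    exact hc
  obtain ⟨P, rfl⟩ := h a
  obtain ⟨Q, rfl⟩ := h b
  rw [← map_mul, mul_comm, map_mul]

end Generators

/-! ### Detecting zero by evaluation at generic matrices. -/

section Evaluation

variable {n : ℕ} {V : Type*} [AddCommGroup V] [Module ℂ V]

/-- Evaluation of a polynomial map `gl_n → End V` at a matrix. -/
def evEnd (A : Matrix (Fin n) (Fin n) ℂ) : PolyEnd n V →ₐ[ℂ] Module.End ℂ V :=
  (Algebra.TensorProduct.lift ((Algebra.ofId ℂ (Module.End ℂ V)).comp (evalAt A))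
    (AlgHom.id ℂ (Module.End ℂ V)) (fun f e => Algebra.commute_algebraMap_left (evalAt A f) e) :
    PolyGl n ⊗[ℂ] Module.End ℂ V →ₐ[ℂ] Module.End ℂ V)

theorem evEnd_tmulEnd (A : Matrix (Fin n) (Fin n) ℂ) (f : PolyGl n) (e : Module.End ℂ V) :
    evEnd A (tmulEnd f e) = evalAt A f • e := by
  have h := Algebra.TensorProduct.lift_tmul ((Algebra.ofId ℂ (Module.End ℂ V)).comp (evalAt A))
    (AlgHom.id ℂ (Module.End ℂ V))
    (fun f e => Algebra.commute_algebraMap_left (evalAt A f) e) f e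
  refine h.trans ?_
  rw [AlgHom.comp_apply, Algebra.ofId_apply, AlgHom.id_apply, ← Algebra.smul_def]

theorem evEnd_algebraMap (A : Matrix (Fin n) (Fin n) ℂ) (r : InvRing n) :
    evEnd A (algebraMap (InvRing n) (PolyEnd n V) r) =
      evalAt A (toPoly r) • (1 : Module.End ℂ V) := by
  rw [algebraMap_polyEnd, evEnd_tmulEnd]
  rfl

theorem evEnd_matOp (π : Matrix (Fin n) (Fin n) ℂ →ₗ⁅ℂ⁆ Module.End ℂ V)
    (A : Matrix (Fin n) (Fin n) ℂ) (Z : PolyMat n) :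
    evEnd A (matOp π Z) = π (Z.map (evalAt A)) := by
  conv_rhs => rw [Matrix.matrix_eq_sum_single (Z.map (evalAt A))]
  simp only [matOp_apply, map_sum, evEnd_tmulEnd]
  refine Finset.sum_congr rfl fun i _ => Finset.sum_congr rfl fun j _ => ?_
  rw [← map_smul, Matrix.smul_single, Matrix.map_apply, smul_eq_mul, mul_one]

theorem evEnd_matOp_pow (π : Matrix (Fin n) (Fin n) ℂ →ₗ⁅ℂ⁆ Module.End ℂ V)
    (A : Matrix (Fin n) (Fin n) ℂ) (k : ℕ) :
    evEnd A (matOp π (genericMatrix n ^ k)) = π (A ^ k) := by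
  rw [evEnd_matOp, ← AlgHom.mapMatrix_apply, map_pow, AlgHom.mapMatrix_apply, evalAt_generic]

/-- The discriminant `r` of the characteristic polynomial is nonzero, as `diag(0, …, n-1)` shows,
and `f * r` vanishes everywhere. -/
theorem eq_zero_of_evalAt_separable {f : PolyGl n}
    (hf : ∀ A : Matrix (Fin n) (Fin n) ℂ, A.charpoly.Separable → evalAt A f = 0) : f = 0 := by
  let p := (genericMatrix n).charpoly
  -- Fixing the formal degrees makes the resultant commute with specialization.
  let r : PolyGl n := Polynomial.resultant p p.derivative n (n - 1)
  have hr : ∀ A : Matrix (Fin n) (Fin n) ℂ,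
      evalAt A r = Polynomial.resultant A.charpoly A.charpoly.derivative := fun A => by
    have h1 : p.map (evalAt A).toRingHom = A.charpoly := by
      rw [← Matrix.charpoly_map (genericMatrix n) (evalAt A).toRingHom]
      congr 1
      exact evalAt_generic A
    have h2 : A.charpoly.natDegree = n := by
      rw [Matrix.charpoly_natDegree_eq_dim, Fintype.card_fin]
    rw [Polynomial.natDegree_derivative, h2, ← h1, Polynomial.derivative_map,
      Polynomial.resultant_map_map]
    rfl
  have hr0 : r ≠ 0 := by
    intro h
    have h1 := hr (Matrix.diagonal fun i : Fin n => ((i : ℕ) : ℂ))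
    rw [h, map_zero, eq_comm, Polynomial.resultant_eq_zero_iff] at h1
    refine h1.2 ?_
    rw [← Polynomial.separable_def, Matrix.charpoly_diagonal]
    refine Polynomial.separable_prod_X_sub_C_iff.mpr ?_
    intro i j hij
    exact Fin.ext (Nat.cast_injective hij)
  have hfr : f * r = 0 := by
    apply MvPolynomial.funext
    intro a
    rw [map_mul, eval_eq_evalAt, eval_eq_evalAt, map_zero]
    generalize (Matrix.of fun i j => a (i, j) : Matrix (Fin n) (Fin n) ℂ) = A
    by_cases hA : A.charpoly.Separable
    · rw [hf A hA, zero_mul]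
    · rw [hr A, Polynomial.resultant_eq_zero_iff.mpr, mul_zero]
      exact ⟨Or.inl (Matrix.charpoly_monic A).ne_zero, hA⟩
  exact (mul_eq_zero.mp hfr).resolve_right hr0

/-- Reduces to polynomials by taking coordinates in a basis of `End V`. -/
theorem eq_zero_of_evEnd_separable {F : PolyEnd n V}
    (hF : ∀ A : Matrix (Fin n) (Fin n) ℂ, A.charpoly.Separable → evEnd A F = 0) : F = 0 := by
  classical
  let b := Module.Basis.ofVectorSpace ℂ (Module.End ℂ V)
  have hev : ∀ (A : Matrix (Fin n) (Fin n) ℂ) (G : PolyGl n ⊗[ℂ] Module.End ℂ V) i,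
      evalAt A (TensorProduct.equivFinsuppOfBasisRight b G i) = b.coord i (evEnd A G) := by
    intro A G i
    induction G using TensorProduct.induction_on with
    | zero =>
      rw [map_zero, Finsupp.zero_apply, map_zero]
      exact (map_zero ((b.coord i).comp (evEnd (V := V) A).toLinearMap)).symm
    | add G G' hG hG' =>
      rw [map_add, Finsupp.add_apply, map_add, hG, hG']
      exact (map_add ((b.coord i).comp (evEnd (V := V) A).toLinearMap) G G').symm
    | tmul f e =>
      rw [TensorProduct.equivFinsuppOfBasisRight_apply_tmul_apply, map_smul]
      have h := evEnd_tmulEnd A f e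
      rw [tmulEnd] at h
      rw [h, map_smul, Module.Basis.coord_apply, smul_eq_mul, smul_eq_mul, mul_comm]
  apply (TensorProduct.equivFinsuppOfBasisRight (M := PolyGl n) b).injective
  refine (Finsupp.ext fun i => ?_).trans (map_zero _).symm
  apply eq_zero_of_evalAt_separable
  intro A hA
  refine (hev A F i).trans ?_
  rw [hF A hA, map_zero]

/-- The Vandermonde determinant vanishes wherever the diagonal entries are not distinct, so its
product with the restriction of `f` is zero. -/
theorem eq_zero_of_evalAt_diagonal {f : PolyGl n} (hf : f ∈ invariantRing n)
    (h : ∀ d : Fin n → ℂ, Function.Injective d → evalAt (Matrix.diagonal d) f = 0) : f = 0 := by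
  apply eq_zero_of_diagRestr hf
  have hV : (Matrix.vandermonde (X : Fin n → MvPolynomial (Fin n) ℂ)).det ≠ 0 :=
    Matrix.det_vandermonde_ne_zero_iff.mpr (X_injective (R := ℂ))
  refine (mul_eq_zero.mp (?_ : diagRestr n f * _ = 0)).resolve_right hV
  apply MvPolynomial.funext
  intro d
  rw [map_mul, eval_diagRestr, map_zero]
  by_cases hd : Function.Injective d
  · rw [h d hd, zero_mul]
  · have h1 : eval d (Matrix.vandermonde (X : Fin n → MvPolynomial (Fin n) ℂ)).det =
        (Matrix.vandermonde d).det := by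
      rw [RingHom.map_det]
      congr 1
      ext i j
      simp [Matrix.vandermonde_apply]
    rw [h1, not_ne_iff.mp (mt Matrix.det_vandermonde_ne_zero_iff.mp hd), mul_zero]

end Evaluation

/-! ### Weight vectors and equivariance on the symmetric power. -/

section Substitution

variable {n : ℕ} {m : ℕ}

theorem polyAct_mul (A : Matrix (Fin n) (Fin n) ℂ) (f g : MvPolynomial (Fin n) ℂ) :
    polyAct A (f * g) = f * polyAct A g + g * polyAct A f := by
  simp only [polyAct_apply, Finset.mul_sum, ← Finset.sum_add_distrib]
  refine Finset.sum_congr rfl fun i _ => Finset.sum_congr rfl fun j _ => ?_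
  rw [Derivation.leibniz, smul_eq_mul, smul_eq_mul, mul_add, smul_add, mul_smul_comm,
    mul_smul_comm, mul_left_comm, mul_left_comm (X i) g]

theorem polyAct_C (A : Matrix (Fin n) (Fin n) ℂ) (c : ℂ) :
    polyAct A (C c) = 0 := by
  simp [polyAct_apply]

theorem polyAct_X (A : Matrix (Fin n) (Fin n) ℂ) (k : Fin n) :
    polyAct A (X k) = ∑ i : Fin n, A i k • X i := by
  rw [polyAct_apply]
  refine Finset.sum_congr rfl fun i _ => ?_
  rw [Finset.sum_eq_single k]
  · simp
  · intro j _ hj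
    simp [pderiv_X_of_ne hj.symm]
  · simp

theorem polyAct_diagonal_prod {ι : Type*} (c : Fin n → ℂ) (s : Finset ι) (i : ι → Fin n) :
    polyAct (Matrix.diagonal c) (∏ l ∈ s, X (i l)) =
      (∑ l ∈ s, c (i l)) • ∏ l ∈ s, (X (i l) : MvPolynomial (Fin n) ℂ) := by
  classical
  induction s using Finset.induction_on with
  | empty => simpa using polyAct_C (Matrix.diagonal c) 1
  | insert a s ha ih =>
    have hX : polyAct (Matrix.diagonal c) (X (i a)) = c (i a) • X (i a) := by
      rw [polyAct_X, Finset.sum_eq_single (i a)]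
      · simp
      · intro b _ hb
        simp [hb]
      · simp
    rw [Finset.prod_insert ha, Finset.sum_insert ha, polyAct_mul, ih, hX, mul_smul_comm,
      mul_smul_comm, mul_comm (∏ l ∈ s, _) (X (i a)), ← add_smul, add_comm]

/-- The linear substitution by `g` on polynomials. -/
def linSubst (g : Matrix (Fin n) (Fin n) ℂ) :
    MvPolynomial (Fin n) ℂ →ₐ[ℂ] MvPolynomial (Fin n) ℂ :=
  aeval fun j => ∑ i, g i j • X i

theorem linSubst_X (g : Matrix (Fin n) (Fin n) ℂ) (j : Fin n) :
    linSubst g (X j) = ∑ i, g i j • X i := aeval_X _ _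

theorem linSubst_mem (g : Matrix (Fin n) (Fin n) ℂ) (f : MvPolynomial (Fin n) ℂ)
    (hf : f ∈ homogeneousSubmodule (Fin n) ℂ m) :
    linSubst g f ∈ homogeneousSubmodule (Fin n) ℂ m := by
  rw [mem_homogeneousSubmodule] at hf ⊢
  have h := hf.aeval (n := 1) (fun j => ∑ i, g i j • (X i : MvPolynomial (Fin n) ℂ)) fun j =>
    (homogeneousSubmodule (Fin n) ℂ 1).sum_mem fun i _ =>
      Submodule.smul_mem _ _ (isHomogeneous_X ℂ i)
  rwa [one_mul] at h

theorem linSubst_linSubst (g h : Matrix (Fin n) (Fin n) ℂ) (f : MvPolynomial (Fin n) ℂ) :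
    linSubst g (linSubst h f) = linSubst (g * h) f := by
  have key : (linSubst g).comp (linSubst h) = linSubst (g * h) := by
    apply MvPolynomial.algHom_ext
    intro k
    rw [AlgHom.comp_apply, linSubst_X, linSubst_X, map_sum]
    simp only [map_smul, linSubst_X, Finset.smul_sum, smul_smul, Matrix.mul_apply, Finset.sum_smul]
    rw [Finset.sum_comm]
    simp only [mul_comm]
  exact DFunLike.congr_fun key f

theorem linSubst_one (f : MvPolynomial (Fin n) ℂ) : linSubst 1 f = f := by
  have key : linSubst (1 : Matrix (Fin n) (Fin n) ℂ) = AlgHom.id ℂ _ := by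
    apply MvPolynomial.algHom_ext
    intro k
    rw [linSubst_X, Finset.sum_eq_single k]
    · simp
    · intro b _ hb
      simp [hb]
    · simp
  exact DFunLike.congr_fun key f

/-- Both sides obey the same Leibniz rule along the substitution, so it is enough to compare them on
variables, where the claim is `h`. In this form `g` need not be invertible. -/
theorem polyAct_linSubst {A A' g : Matrix (Fin n) (Fin n) ℂ} (h : A' * g = g * A)
    (f : MvPolynomial (Fin n) ℂ) :
    polyAct A' (linSubst g f) = linSubst g (polyAct A f) := by
  induction f using MvPolynomial.induction_on with
  | C c =>
    rw [polyAct_C, map_zero, ← algebraMap_eq, AlgHom.commutes, algebraMap_eq, polyAct_C]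
  | add p q hp hq => simp only [map_add, hp, hq]
  | mul_X p k hp =>
    rw [map_mul, polyAct_mul, polyAct_mul, map_add, map_mul, map_mul, hp]
    congr 2
    rw [linSubst_X, polyAct_X, map_sum, map_sum]
    simp only [map_smul, polyAct_X, linSubst_X, Finset.smul_sum, smul_smul]
    rw [Finset.sum_comm]
    conv_rhs => rw [Finset.sum_comm]
    refine Finset.sum_congr rfl fun i _ => ?_
    rw [← Finset.sum_smul, ← Finset.sum_smul]
    congr 1
    have hik := congrFun (congrFun h i) k
    rw [Matrix.mul_apply, Matrix.mul_apply] at hik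
    simp only [mul_comm (g _ k), mul_comm (A _ k)]
    exact hik

variable (m) in
/-- The action of a matrix on the symmetric power `S^m(ℂ^n)`. -/
def symPowSubst (g : Matrix (Fin n) (Fin n) ℂ) :
    Module.End ℂ (homogeneousSubmodule (Fin n) ℂ m) :=
  (linSubst g).toLinearMap.restrict (linSubst_mem g)

theorem symPowSubst_mul (g h : Matrix (Fin n) (Fin n) ℂ) :
    symPowSubst m g * symPowSubst m h = symPowSubst m (g * h) := by
  ext1 f
  exact Subtype.ext (linSubst_linSubst g h f)

theorem symPowSubst_one : symPowSubst m (1 : Matrix (Fin n) (Fin n) ℂ) = 1 := by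
  ext1 f
  exact Subtype.ext (linSubst_one _)

theorem symPowRep_mul_symPowSubst {A A' g : Matrix (Fin n) (Fin n) ℂ} (h : A' * g = g * A) :
    symPowRep n m A' * symPowSubst m g = symPowSubst m g * symPowRep n m A := by
  ext1 f
  exact Subtype.ext (polyAct_linSubst h _)

/-- The monomial `∏ l, x_{i l}`, as an element of the symmetric power. -/
def monom (i : Fin m → Fin n) : homogeneousSubmodule (Fin n) ℂ m :=
  ⟨∏ l, X (i l), by
    have h := IsHomogeneous.prod (Finset.univ : Finset (Fin m))
      (fun l => (X (i l) : MvPolynomial (Fin n) ℂ)) (fun _ => 1) fun l _ => isHomogeneous_X ℂ (i l)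
    rw [mem_homogeneousSubmodule]
    simpa using h⟩

theorem monom_ne_zero (i : Fin m → Fin n) : monom i ≠ 0 := by
  intro h
  have h1 : ∏ l, (X (i l) : MvPolynomial (Fin n) ℂ) = 0 := congrArg Subtype.val h
  exact Finset.prod_ne_zero_iff.mpr (fun l _ => X_ne_zero (i l)) h1

theorem symPowRep_diagonal_monom (c : Fin n → ℂ) (i : Fin m → Fin n) :
    symPowRep n m (Matrix.diagonal c) (monom i) = (∑ l, c (i l)) • monom i :=
  Subtype.ext (polyAct_diagonal_prod c Finset.univ i)

/-- Monomials span. Each exponent vector of degree `m` becomes a sequence of indices by listing its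
variables with multiplicity. -/
theorem end_eq_zero_of_monom {T : Module.End ℂ (homogeneousSubmodule (Fin n) ℂ m)}
    (hT : ∀ i : Fin m → Fin n, T (monom i) = 0) : T = 0 := by
  have hmon : ∀ s : Fin n →₀ ℕ, s.degree = m →
      ∃ i : Fin m → Fin n, (monom i : MvPolynomial (Fin n) ℂ) = monomial s 1 := by
    intro s hs
    have hlen : s.toMultiset.toList.length = m := by
      rw [Multiset.length_toList, Finsupp.card_toMultiset, ← hs]
      rfl
    subst hlen
    refine ⟨fun l => s.toMultiset.toList[l], ?_⟩
    refine (Fin.prod_univ_fun_getElem s.toMultiset.toList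
      fun j => (X j : MvPolynomial (Fin n) ℂ)).trans ?_
    rw [← Multiset.prod_coe, ← Multiset.map_coe, Multiset.coe_toList, Finsupp.toMultiset_map,
      Finsupp.prod_toMultiset]
    rw [Finsupp.prod_mapDomain_index (by simp) (by simp [pow_add]), monomial_eq, C_1, one_mul]
  ext1 f
  rw [LinearMap.zero_apply]
  have hdeg : ∀ s : (f : MvPolynomial (Fin n) ℂ).support, s.1.degree = m := fun s => by
    have h := (mem_homogeneousSubmodule _ _).mp f.2 (mem_support_iff.mp s.2)
    rw [Finsupp.degree_eq_weight_one]
    exact h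
  have hf : f = ∑ s ∈ (f : MvPolynomial (Fin n) ℂ).support.attach,
      (coeff s.1 (f : MvPolynomial (Fin n) ℂ)) • monom (hmon s.1 (hdeg s)).choose := by
    apply Subtype.ext
    rw [Submodule.coe_sum]
    conv_lhs => rw [(f : MvPolynomial (Fin n) ℂ).as_sum, ← Finset.sum_attach]
    refine Finset.sum_congr rfl fun s _ => ?_
    rw [Submodule.coe_smul, (hmon s.1 (hdeg s)).choose_spec, smul_monomial, smul_eq_mul, mul_one]
  rw [hf, map_sum]
  exact Finset.sum_eq_zero fun s _ => by rw [map_smul, hT, smul_zero]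

end Substitution

/-! ### Characters of tensor powers. -/

section TensorCharacters

variable {R A K : Type*} [CommRing R] [Ring A] [Algebra R A] [CommRing K] {m : ℕ}

/-- The product of characters of `A` that restrict to the same character `φ` of `R`, as a
character of the tensor power of `A` over `R`. -/
theorem exists_tensorChar (φ : R →+* K) (χ : Fin m → A →+* K)
    (h : ∀ l r, χ l (algebraMap R A r) = φ r) :
    ∃ ψ : (⨂[R] _ : Fin m, A) →+* K, (∀ r, ψ (algebraMap R _ r) = φ r) ∧
      ∀ a : Fin m → A, ψ (PiTensorProduct.tprod R a) = ∏ l, χ l (a l) := by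
  -- Viewing `K` as an `R`-algebra through `φ` makes all the characters `R`-linear, so their product
  -- descends to the tensor power.
  let : Algebra R K := φ.toAlgebra
  let χ' : Fin m → A →ₐ[R] K := fun l => { χ l with commutes' := h l }
  let f : MultilinearMap R (fun _ : Fin m => A) K :=
    (MultilinearMap.mkPiAlgebra R (Fin m) K).compLinearMap fun l => (χ' l).toLinearMap
  have hf : ∀ a, f a = ∏ l, χ l (a l) := fun a => rfl
  let ψ : (⨂[R] _ : Fin m, A) →ₐ[R] K := PiTensorProduct.liftAlgHom f
    (by rw [hf]; simp) (by intro x y; rw [hf, hf, hf, ← Finset.prod_mul_distrib]; simp)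
  refine ⟨ψ.toRingHom, fun r => ψ.commutes r, fun a => ?_⟩
  rw [← hf a]
  exact PiTensorProduct.lift.tprod a

theorem tensorChar_tensorTrace {ψ : (⨂[R] _ : Fin m, A) →+* K} {χ : Fin m → A →+* K}
    (hψ : ∀ a : Fin m → A, ψ (PiTensorProduct.tprod R a) = ∏ l, χ l (a l)) (a : A) :
    ψ (tensorTrace m a) = ∑ l, χ l a := by
  rw [tensorTrace, map_sum]
  refine Finset.sum_congr rfl fun l _ => ?_
  rw [PiTensorProduct.singleAlgHom_apply, hψ, Finset.prod_eq_single l]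
  · simp
  · intro k _ hk
    simp [hk]
  · simp

end TensorCharacters

/-! ### The graph of the isomorphism and its two projections. -/

section Joint

variable {n : ℕ}

/-- Evaluation of invariant polynomials at a matrix. -/
def invEval (A : Matrix (Fin n) (Fin n) ℂ) : InvRing n →+* ℂ :=
  (evalAt A).toRingHom.comp (invariantRing n).val.toRingHom

/-- The character is the eigenvalue on `x_j`, a common eigenvector of the whole algebra evaluated at
`diag(d)`. Defining it this way avoids having to know the relations satisfied by `y`. -/
theorem exists_vecChar (d : Fin n → ℂ) (j : Fin n) :
    ∃ χ : bigAlgebra (symPowRep n 1) →+* ℂ,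
      (∀ r, χ (algebraMap (InvRing n) _ r) = invEval (Matrix.diagonal d) r) ∧
      ∀ k : ℕ, χ (vecGen n ^ k) = d j ^ k := by
  let v : homogeneousSubmodule (Fin n) ℂ 1 := monom fun _ => j
  have hv : v ≠ 0 := monom_ne_zero _
  have hpow : ∀ k : ℕ, evEnd (Matrix.diagonal d)
      (matOp (symPowRep n 1) (genericMatrix n ^ k)) v = d j ^ k • v := by
    intro k
    rw [evEnd_matOp_pow, Matrix.diagonal_pow, symPowRep_diagonal_monom]
    simp [v]
  have hadj : ∀ F ∈ Algebra.adjoin (InvRing n) (Set.range fun k : ℕ =>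
      matOp (symPowRep n 1) (genericMatrix n ^ k)), ∃ c : ℂ,
      evEnd (Matrix.diagonal d) F v = c • v := by
    intro F hF
    induction hF using Algebra.adjoin_induction with
    | mem F hF =>
      obtain ⟨k, rfl⟩ := hF
      exact ⟨_, hpow k⟩
    | algebraMap r => exact ⟨evalAt (Matrix.diagonal d) (toPoly r), by rw [evEnd_algebraMap]; rfl⟩
    | add F G _ _ hF hG =>
      obtain ⟨c, hc⟩ := hF
      obtain ⟨c', hc'⟩ := hG
      exact ⟨c + c', by rw [map_add, LinearMap.add_apply, hc, hc', add_smul]⟩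
    | mul F G _ _ hF hG =>
      obtain ⟨c, hc⟩ := hF
      obtain ⟨c', hc'⟩ := hG
      exact ⟨c' * c, by rw [map_mul, Module.End.mul_apply, hc', map_smul, hc, smul_smul]⟩
  have hex : ∀ a : bigAlgebra (symPowRep n 1), ∃ c : ℂ,
      evEnd (Matrix.diagonal d) a.1 v = c • v := fun a =>
    hadj a.1 (bigAlgebra_symPowRep_eq_adjoin (n := n) 1 ▸ a.2)
  choose χ hχ using hex
  have huniq : ∀ (a : bigAlgebra (symPowRep n 1)) (c : ℂ),
      evEnd (Matrix.diagonal d) a.1 v = c • v → χ a = c := fun a c hc =>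
    smul_left_injective ℂ hv ((hχ a).symm.trans hc)
  refine ⟨{ toFun := χ, map_one' := ?_, map_mul' := ?_, map_zero' := ?_, map_add' := ?_ },
    fun r => ?_, fun k => ?_⟩
  · exact huniq _ _ (by rw [OneMemClass.coe_one, map_one, one_smul]; rfl)
  · intro a b
    refine huniq _ _ ?_
    rw [MulMemClass.coe_mul, map_mul, Module.End.mul_apply, hχ b, map_smul, hχ a, smul_smul,
      mul_comm]
  · exact huniq _ _ (by rw [ZeroMemClass.coe_zero, map_zero, zero_smul]; rfl)
  · intro a b
    refine huniq _ _ ?_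
    rw [AddMemClass.coe_add, map_add, LinearMap.add_apply, hχ a, hχ b, add_smul]
  · refine huniq _ _ ?_
    have h := evEnd_algebraMap (V := homogeneousSubmodule (Fin n) ℂ 1) (Matrix.diagonal d) r
    exact (LinearMap.congr_fun h v).trans rfl
  · refine huniq _ _ ?_
    rw [coe_vecGen_pow, hpow]

theorem exists_diagChar {m : ℕ} (d : Fin n → ℂ) (i : Fin m → Fin n) :
    ∃ ψ : (⨂[InvRing n] _ : Fin m, bigAlgebra (symPowRep n 1)) →+* ℂ,
      (∀ r, ψ (algebraMap (InvRing n) _ r) = invEval (Matrix.diagonal d) r) ∧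
      (∀ a : Fin m → ℕ, ψ (PiTensorProduct.tprod _ fun l => vecGen n ^ a l) =
        ∏ l, d (i l) ^ a l) ∧
      ∀ k : ℕ, ψ (tensorTrace m (vecGen n ^ k)) = ∑ l, d (i l) ^ k := by
  choose χ hχ hχ' using fun l => exists_vecChar d (i l)
  obtain ⟨ψ, hψ, hψ'⟩ := exists_tensorChar (invEval (Matrix.diagonal d)) χ hχ
  refine ⟨ψ, hψ, fun a => ?_, fun k => ?_⟩
  · rw [hψ']
    exact Finset.prod_congr rfl fun l _ => hχ' l _
  · rw [tensorChar_tensorTrace hψ']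
    exact Finset.sum_congr rfl fun l _ => hχ' l _

/-- The character of the tensor power of the big algebra of `ℂ^n` that is given by a diagonal
matrix and a sequence of its eigenvectors. -/
def diagChar {m : ℕ} (d : Fin n → ℂ) (i : Fin m → Fin n) :
    (⨂[InvRing n] _ : Fin m, bigAlgebra (symPowRep n 1)) →+* ℂ :=
  (exists_diagChar d i).choose

theorem diagChar_algebraMap {m : ℕ} (d : Fin n → ℂ) (i : Fin m → Fin n) (r : InvRing n) :
    diagChar d i (algebraMap (InvRing n) _ r) = invEval (Matrix.diagonal d) r :=
  (exists_diagChar d i).choose_spec.1 r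

theorem diagChar_tprod {m : ℕ} (d : Fin n → ℂ) (i : Fin m → Fin n) (a : Fin m → ℕ) :
    diagChar d i (PiTensorProduct.tprod _ fun l => vecGen n ^ a l) = ∏ l, d (i l) ^ a l :=
  (exists_diagChar d i).choose_spec.2.1 a

theorem diagChar_tensorTrace {m : ℕ} (d : Fin n → ℂ) (i : Fin m → Fin n) (k : ℕ) :
    diagChar d i (tensorTrace m (vecGen n ^ k)) = ∑ l, d (i l) ^ k :=
  (exists_diagChar d i).choose_spec.2.2 k

/-- Expand `z` in tensors of powers of `y` with exponents below `n`. At `diag(d)` with distinct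
entries the coefficients form a polynomial of degree below `n` in each variable that vanishes on the
grid `{d_1, …, d_n}^m`, so they all vanish there. An invariant that is zero at all such matrices is
zero. -/
theorem eq_zero_of_diagChar {m : ℕ} {z : ⨂[InvRing n] _ : Fin m, bigAlgebra (symPowRep n 1)}
    (hz : ∀ (d : Fin n → ℂ) (i : Fin m → Fin n), diagChar d i z = 0) : z = 0 := by
  obtain ⟨r, rfl⟩ := exists_tprod_pow_expansion m (span_vecGen_pow n) z
  suffices h : ∀ a, r a = 0 from Finset.sum_eq_zero fun a _ => by rw [h a, zero_smul]
  intro a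
  let e : (Fin m → Fin n) → (Fin m →₀ ℕ) := fun b =>
    Finsupp.equivFunOnFinite.symm fun l => (b l : ℕ)
  have he : Function.Injective e := by
    intro b b' hb
    funext l
    exact Fin.ext (DFunLike.congr_fun hb l)
  apply Subtype.ext
  refine eq_zero_of_evalAt_diagonal (toPoly_mem (r a)) fun d hd => ?_
  let P : MvPolynomial (Fin m) ℂ :=
    ∑ b, monomial (e b) (invEval (Matrix.diagonal d) (r b))
  have hP : P = 0 := by
    apply eq_zero_of_eval_zero_at_prod_finset P fun _ => Finset.univ.image d
    · intro l
      rw [Finset.card_image_of_injective _ hd, Finset.card_fin]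
      have hn : 0 < n := (Nat.zero_le _).trans_lt (a l).2
      refine (degreeOf_sum_le l _ _).trans_lt ((Finset.sup_lt_iff (by simpa using hn)).mpr ?_)
      intro b _
      refine lt_of_le_of_lt (degreeOf_le_iff.mpr fun s hs => ?_) (b l).2
      rw [Finset.mem_singleton.mp (support_monomial_subset hs)]
      rfl
    · intro x hx
      have hx' : ∀ l, ∃ j, d j = x l := fun l => by simpa using hx l
      choose i hi using hx'
      have h := hz d i
      rw [map_sum] at h
      rw [map_sum, ← h]
      refine Finset.sum_congr rfl fun b _ => ?_
      rw [eval_monomial, Algebra.smul_def, map_mul, diagChar_algebraMap, diagChar_tprod]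
      congr 1
      rw [Finsupp.prod_fintype _ _ (by simp)]
      refine Finset.prod_congr rfl fun l _ => ?_
      rw [hi]
      rfl
  have hcoeff : coeff (e a) P = invEval (Matrix.diagonal d) (r a) := by
    rw [coeff_sum, Finset.sum_eq_single a]
    · simp
    · intro b _ hb
      rw [coeff_monomial, if_neg fun h => hb (he h)]
    · simp
  rw [hP, coeff_zero] at hcoeff
  exact hcoeff.symm

variable (n) (m : ℕ)

/-- The generator of the joint algebra: an operator on `S^m(ℂ^n)` with the corresponding
symmetric tensor. -/
def jointGen (k : ℕ) : PolyEnd n (homogeneousSubmodule (Fin n) ℂ m) ×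
    ⨂[InvRing n] _ : Fin m, bigAlgebra (symPowRep n 1) :=
  (matOp (symPowRep n m) (genericMatrix n ^ k), tensorTrace m (vecGen n ^ k))

/-- The graph of the isomorphism between the big algebra of `S^m(ℂ^n)` and the symmetric power
of the big algebra of `ℂ^n`. -/
def jointAlgebra : Subalgebra (InvRing n) (PolyEnd n (homogeneousSubmodule (Fin n) ℂ m) ×
    ⨂[InvRing n] _ : Fin m, bigAlgebra (symPowRep n 1)) :=
  Algebra.adjoin _ (Set.range (jointGen n m))

variable {n m}

/-- The link between the two components: on generators both sides give `∑ d_{i l}^k`, and the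
relation is stable under sums and products. -/
theorem evEnd_diagonal_monom_of_mem_joint {x : PolyEnd n (homogeneousSubmodule (Fin n) ℂ m) ×
      ⨂[InvRing n] _ : Fin m, bigAlgebra (symPowRep n 1)} (hx : x ∈ jointAlgebra n m)
    (d : Fin n → ℂ) (i : Fin m → Fin n) :
    evEnd (Matrix.diagonal d) x.1 (monom i) = diagChar d i x.2 • monom i := by
  rw [jointAlgebra] at hx
  induction hx using Algebra.adjoin_induction with
  | mem x hx =>
    obtain ⟨k, rfl⟩ := hx
    rw [jointGen, diagChar_tensorTrace, evEnd_matOp_pow, Matrix.diagonal_pow,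
      symPowRep_diagonal_monom]
    rfl
  | algebraMap r =>
    rw [Prod.algebraMap_apply, diagChar_algebraMap, evEnd_algebraMap]
    rfl
  | add x y _ _ hx hy =>
    rw [Prod.fst_add, Prod.snd_add, map_add, map_add, LinearMap.add_apply, hx, hy, add_smul]
  | mul x y _ _ hx hy =>
    rw [Prod.fst_mul, Prod.snd_mul, map_mul, map_mul, Module.End.mul_apply, hy, map_smul, hx,
      smul_smul, mul_comm]

theorem evEnd_mul_symPowSubst_of_mem_joint {x : PolyEnd n (homogeneousSubmodule (Fin n) ℂ m) ×
      ⨂[InvRing n] _ : Fin m, bigAlgebra (symPowRep n 1)} (hx : x ∈ jointAlgebra n m)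
    (g : GL (Fin n) ℂ) (A : Matrix (Fin n) (Fin n) ℂ) :
    evEnd ((g : Matrix (Fin n) (Fin n) ℂ) * A * ((g⁻¹ : GL (Fin n) ℂ) : Matrix _ _ ℂ)) x.1 *
      symPowSubst m g = symPowSubst m g * evEnd A x.1 := by
  rw [jointAlgebra] at hx
  induction hx using Algebra.adjoin_induction with
  | mem x hx =>
    obtain ⟨k, rfl⟩ := hx
    rw [jointGen, evEnd_matOp_pow, evEnd_matOp_pow]
    apply symPowRep_mul_symPowSubst
    rw [Units.conj_pow, mul_assoc, Units.inv_mul, mul_one]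
  | algebraMap r =>
    rw [Prod.algebraMap_apply, evEnd_algebraMap, evEnd_algebraMap, ← evalAt_adSubst,
      toPoly_mem r g, smul_mul_assoc, mul_smul_comm, one_mul, mul_one]
  | add x y _ _ hx hy => rw [Prod.fst_add, map_add, map_add, add_mul, mul_add, hx, hy]
  | mul x y _ _ hx hy =>
    rw [Prod.fst_mul, map_mul, map_mul, mul_assoc, hy, ← mul_assoc, hx, mul_assoc]

/-- All eigenvalues at diagonal matrices are character values of the zero tensor. Equivariance
carries the vanishing to diagonalizable matrices with separable characteristic polynomial, which
suffice. -/
theorem fst_eq_zero_of_mem_joint {x : PolyEnd n (homogeneousSubmodule (Fin n) ℂ m) ×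
      ⨂[InvRing n] _ : Fin m, bigAlgebra (symPowRep n 1)} (hx : x ∈ jointAlgebra n m)
    (h0 : x.2 = 0) : x.1 = 0 := by
  apply eq_zero_of_evEnd_separable
  intro A hA
  obtain ⟨g, d, hg⟩ := exists_diag A hA
  have h1 := evEnd_mul_symPowSubst_of_mem_joint hx g A
  have h2 : evEnd (Matrix.diagonal d) x.1 = 0 := end_eq_zero_of_monom fun i => by
    rw [evEnd_diagonal_monom_of_mem_joint hx, h0, map_zero, zero_smul]
  rw [hg, h2, zero_mul] at h1
  have h3 : symPowSubst m ((g⁻¹ : GL (Fin n) ℂ) : Matrix (Fin n) (Fin n) ℂ) *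
      symPowSubst m (g : Matrix (Fin n) (Fin n) ℂ) = 1 := by
    rw [symPowSubst_mul, Units.inv_mul, symPowSubst_one]
  rw [← one_mul (evEnd A x.1), ← h3, mul_assoc, ← h1, mul_zero]

/-- The monomials are nonzero, so a zero operator forces every character value to vanish. -/
theorem snd_eq_zero_of_mem_joint {x : PolyEnd n (homogeneousSubmodule (Fin n) ℂ m) ×
      ⨂[InvRing n] _ : Fin m, bigAlgebra (symPowRep n 1)} (hx : x ∈ jointAlgebra n m)
    (h0 : x.1 = 0) : x.2 = 0 := by
  refine eq_zero_of_diagChar fun d i => ?_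
  have h := evEnd_diagonal_monom_of_mem_joint hx d i
  rw [h0, map_zero, LinearMap.zero_apply, eq_comm] at h
  exact (smul_eq_zero.mp h).resolve_right (monom_ne_zero i)

variable (n m)

theorem jointAlgebra_map_fst :
    (jointAlgebra n m).map (AlgHom.fst (InvRing n) _ _) = bigAlgebra (symPowRep n m) := by
  rw [jointAlgebra, AlgHom.map_adjoin, ← Set.range_comp]
  exact (bigAlgebra_symPowRep_eq_adjoin m).symm

theorem jointAlgebra_map_snd : (jointAlgebra n m).map (AlgHom.snd (InvRing n) _ _) =
    symPower (InvRing n) (bigAlgebra (symPowRep n 1)) m := by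
  let : Algebra ℚ (InvRing n) := ((algebraMap ℂ (InvRing n)).comp (algebraMap ℚ ℂ)).toAlgebra
  rw [jointAlgebra, AlgHom.map_adjoin, ← Set.range_comp,
    symPower_eq_adjoin m (bigAlgebra_vec_mul_comm n) (adjoin_vecGen n)]
  rfl

end Joint

end BigAlg

end

theorem theorem8 (n m : ℕ) (hn : 0 < n) (hm : 0 < m) :
    Nonempty (BigAlg.bigAlgebra (BigAlg.symPowRep n m) ≃ₐ[BigAlg.InvRing n]
      BigAlg.symPower (BigAlg.InvRing n) (BigAlg.bigAlgebra (BigAlg.symPowRep n 1)) m) := by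
  let p₁ := (AlgHom.fst (BigAlg.InvRing n) _ _).comp (BigAlg.jointAlgebra n m).val
  let p₂ := (AlgHom.snd (BigAlg.InvRing n) _ _).comp (BigAlg.jointAlgebra n m).val
  -- The difference of two elements of the graph with equal operators has zero first component,
  -- hence zero second component; symmetrically for `h₂`.
  have h₁ : Function.Injective p₁ := fun x y hxy => Subtype.ext (Prod.ext hxy
    (sub_eq_zero.mp (BigAlg.snd_eq_zero_of_mem_joint (sub_mem x.2 y.2) (sub_eq_zero.mpr hxy))))
  have h₂ : Function.Injective p₂ := fun x y hxy => Subtype.ext (Prod.ext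
    (sub_eq_zero.mp (BigAlg.fst_eq_zero_of_mem_joint (sub_mem x.2 y.2) (sub_eq_zero.mpr hxy))) hxy)
  have e₁ : p₁.range = BigAlg.bigAlgebra (BigAlg.symPowRep n m) :=
    (Subalgebra.range_comp_val _ _).trans (BigAlg.jointAlgebra_map_fst n m)
  have e₂ : p₂.range = BigAlg.symPower _ _ m :=
    (Subalgebra.range_comp_val _ _).trans (BigAlg.jointAlgebra_map_snd n m)
  exact ⟨(Subalgebra.equivOfEq _ _ e₁.symm).trans ((AlgEquiv.ofInjective p₁ h₁).symm.trans
    ((AlgEquiv.ofInjective p₂ h₂).trans (Subalgebra.equivOfEq _ _ e₂)))⟩
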